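/- Fix a finite set $AP$ of atomic propositions and let $\Sigma = 2^{AP}$. HyperLTL formulas over $AP$ have the form $\exists\pi.\varphi$, $\forall\pi.\varphi$ or $\psi$ with $\psi ::= a_\pi \mid \neg\psi \mid \psi\vee\psi \mid \bigcirc\psi \mid \psi\,\mathcal U\,\psi$, with the usual semantics over sets $T'\subseteq\Sigma^\omega$ of traces. A formula $\varphi=\forall\pi_1\dots\forall\pi_{k_T}.\psi$ is \emph{universally safe} if $\psi$ is quantifier-free and a safety LTL formula: every $\rho\in(\Sigma^{k_T})^\omega$ violating $\psi$ has a finite prefix all of whose infinite extensions violate $\psi$. A set $T\subseteq\Sigma^*$ is a \emph{bad prefix} of $\varphi$ if every $T'\subseteq\Sigma^\omega$ such that each $t\in T$ is a prefix of some $t'\in T'$ violates $\varphi$. A word $w\in(\Sigma^{k})^*$ is a \emph{representation} of the set $\mathrm{unzip}(w)\subseteq\Sigma^*$ of its $k$ component words. For a DFA $\mathcal A$ let $|\mathcal A|$ be its number of states, and let $|\psi|$ be the number of nodes of the syntax tree of $\psi$. Then there is an algorithm (one program for all $AP$, $k_T$, $k_L$) which, given a universally safe HyperLTL formula $\varphi=\forall\pi_1\dots\forall\pi_{k_T}.\psi$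 and a DFA $\mathcal A$ over $\Sigma^{k_L}$ (given by its transition table), decides whether every word accepted by $\mathcal A$ is a representation of a bad prefix of $\varphi$, and whose running time is polynomial in $|\mathcal A|$, exponential in $|\psi|$ and doubly exponential in $k_T$ whenever $k_L\le k_T$. Precisely, for every finite $AP$ there are polynomials $P,R$ with natural number coefficients such that for all $k_T$, $k_L$, $\varphi$ and $\mathcal A$ as above the algorithm halts with the correct answer after at most $$P(|\mathcal A|)\cdot 2^{\,|\psi|\cdot 2^{R(\max(k_T,k_L))}}$$ steps. Time is measured on a random access machine with unit-cost addition and truncated subtraction. -/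

import Mathlib

/-! ### HyperLTL over the atomic propositions `Fin m`, letters being the sets of propositions -/

/-- The alphabet `Σ = 2^AP` for `AP = Fin m`. -/
abbrev Letter (m : ℕ) : Type := Set (Fin m)

/-- Infinite traces, i.e. elements of `Σ^ω`. -/
abbrev Trace (m : ℕ) : Type := ℕ → Letter m

/-- The suffix `t[i, ∞]`. -/
def Trace.suffix {m : ℕ} (t : Trace m) (i : ℕ) : Trace m := fun j => t (i + j)

/-- Quantifier-free formulas (LTL formulas whose atoms `a_π` are indexed by one of `k` trace
variables). -/
inductive LTL (m k : ℕ) : Type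
  | atom (a : Fin m) (v : Fin k) : LTL m k
  | neg (p : LTL m k) : LTL m k
  | disj (p q : LTL m k) : LTL m k
  | next (p : LTL m k) : LTL m k
  | untl (p q : LTL m k) : LTL m k

namespace LTL

/-- `|ψ|`: the number of nodes of the syntax tree. -/
def size {m k : ℕ} : LTL m k → ℕ
  | atom _ _ => 1
  | neg p => p.size + 1
  | disj p q => p.size + q.size + 1
  | next p => p.size + 1
  | untl p q => p.size + q.size + 1

/-- Satisfaction of a quantifier-free formula under a trace assignment. -/
def Sat {m k : ℕ} : LTL m k → (Fin k → Trace m) → Prop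
  | atom a v, ρ => a ∈ ρ v 0
  | neg p, ρ => ¬ p.Sat ρ
  | disj p q, ρ => p.Sat ρ ∨ q.Sat ρ
  | next p, ρ => p.Sat (fun v => (ρ v).suffix 1)
  | untl p q, ρ => ∃ i, q.Sat (fun v => (ρ v).suffix i) ∧
      ∀ j < i, p.Sat (fun v => (ρ v).suffix j)

/-- `ψ` is a safety LTL formula: every violating word over `Σ^k` has a finite prefix all of whose
infinite extensions are violating. -/
def IsSafety {m k : ℕ} (p : LTL m k) : Prop :=
  ∀ ρ : Fin k → Trace m, ¬ p.Sat ρ →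
    ∃ N : ℕ, ∀ ρ' : Fin k → Trace m, (∀ v, ∀ j < N, ρ' v j = ρ v j) → ¬ p.Sat ρ'

/-- The nodes of the syntax tree in postorder; a node is a triple consisting of its kind and, for
an atom `a_π`, the indices of `a` and of `π`. -/
def postorder {m k : ℕ} : LTL m k → List (ℕ × ℕ × ℕ)
  | atom a v => [(0, (a : ℕ), (v : ℕ))]
  | neg p => p.postorder ++ [(1, 0, 0)]
  | disj p q => p.postorder ++ q.postorder ++ [(2, 0, 0)]
  | next p => p.postorder ++ [(3, 0, 0)]
  | untl p q => p.postorder ++ q.postorder ++ [(4, 0, 0)]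

end LTL

/-- HyperLTL formulas with free trace variables `π_0, …, π_{k-1}`; a quantifier binds the variable
with the largest index of its scope. -/
inductive HyperLTL (m : ℕ) : ℕ → Type
  | qfree {k : ℕ} (p : LTL m k) : HyperLTL m k
  | ex {k : ℕ} (φ : HyperLTL m (k + 1)) : HyperLTL m k
  | all {k : ℕ} (φ : HyperLTL m (k + 1)) : HyperLTL m k

namespace HyperLTL

/-- `ρ ⊨_T φ`. -/
def Sat {m : ℕ} (T : Set (Trace m)) : {k : ℕ} → HyperLTL m k → (Fin k → Trace m) → Prop
  | _, qfree p, ρ => p.Sat ρ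
  | _, ex φ, ρ => ∃ t ∈ T, Sat T φ (Fin.snoc (α := fun _ => Trace m) ρ t)
  | _, all φ, ρ => ∀ t ∈ T, Sat T φ (Fin.snoc (α := fun _ => Trace m) ρ t)

/-- The set of traces `T` satisfies the closed formula `φ`. -/
def Models {m : ℕ} (T : Set (Trace m)) (φ : HyperLTL m 0) : Prop := Sat T φ Fin.elim0

/-- The universal closure `∀ π_0 … ∀ π_{k-1}. φ`. -/
def univClosure {m : ℕ} : (k : ℕ) → HyperLTL m k → HyperLTL m 0
  | 0, φ => φ
  | k + 1, φ => univClosure k (all φ)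

/-- The universal formula `∀ π_0 … ∀ π_{k-1}. ψ`. It is universally safe when `ψ.IsSafety`. -/
def univ {m k : ℕ} (p : LTL m k) : HyperLTL m 0 := univClosure k (qfree p)

end HyperLTL

/-! ### Bad prefixes and their representations -/

/-- The finite trace `t` is a prefix of the infinite trace `τ`. -/
def IsTracePrefix {m : ℕ} (t : List (Letter m)) (τ : Trace m) : Prop :=
  ∀ (j : ℕ) (h : j < t.length), t[j] = τ j

/-- `T ≤ T'` for a set of finite traces and a set of infinite traces. -/
def IsSetPrefix {m : ℕ} (T : Set (List (Letter m))) (T' : Set (Trace m)) : Prop :=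
  ∀ t ∈ T, ∃ t' ∈ T', IsTracePrefix t t'

/-- `T` is a bad prefix of (the hyperproperty given by) `φ`. -/
def IsBadPrefix {m : ℕ} (φ : HyperLTL m 0) (T : Set (List (Letter m))) : Prop :=
  ∀ T' : Set (Trace m), IsSetPrefix T T' → ¬ HyperLTL.Models T' φ

/-- The set of the component words of a word over `Σ^k`. -/
def unzip {m k : ℕ} (w : List (Fin k → Letter m)) : Set (List (Letter m)) :=
  {t | ∃ i : Fin k, t = w.map (fun v => v i)}

/-- The word `w` over `Σ^k` is a representation of the set `T` of finite traces. -/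
def IsRepresentation {m k : ℕ} (w : List (Fin k → Letter m)) (T : Set (List (Letter m))) : Prop :=
  unzip w = T

/-- Every word accepted by the automaton is a representation of a bad prefix of `φ`. -/
def AcceptsOnlyBadPrefixes {m k : ℕ} {Q : Type} (A : DFA (Fin k → Letter m) Q)
    (φ : HyperLTL m 0) : Prop :=
  ∀ w ∈ A.accepts, ∃ T : Set (List (Letter m)), IsBadPrefix φ T ∧ IsRepresentation w T

/-! ### The machine model

Structured programs of a random access machine with unit cost addition and (truncated) subtraction.
The memory consists of arrays of natural numbers; a program names finitely many of them. There is no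
unit cost multiplication, so time on this machine and time on a Turing machine agree up to a
polynomial. -/

namespace RAM

/-- A memory: `s a i` is the content of cell `i` of array `a`. -/
abbrev Store : Type := ℕ → ℕ → ℕ

/-- Expressions; `read a e` is the cell of array `a` whose index is the value of `e`. -/
inductive Expr : Type
  | const (n : ℕ) : Expr
  | read (a : ℕ) (e : Expr) : Expr
  | plus (e f : Expr) : Expr
  | monus (e f : Expr) : Expr

namespace Expr

/-- The value of an expression. -/
def eval (s : Store) : Expr → ℕ
  | const n => n
  | read a e => s a (e.eval s)
  | plus e f => e.eval s + f.eval s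
  | monus e f => e.eval s - f.eval s

/-- The number of steps needed to evaluate an expression. -/
def cost : Expr → ℕ
  | const _ => 1
  | read _ e => e.cost + 1
  | plus e f => e.cost + f.cost + 1
  | monus e f => e.cost + f.cost + 1

end Expr

/-- Programs; `assign a i e` stores the value of `e` in the cell of array `a` whose index is the
value of `i`; `cond` and `loop` test whether the value of an expression is nonzero. -/
inductive Prog : Type
  | skip : Prog
  | assign (a : ℕ) (i e : Expr) : Prog
  | seq (p q : Prog) : Prog
  | cond (e : Expr) (p q : Prog) : Prog
  | loop (e : Expr) (p : Prog) : Prog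

/-- The memory after storing `x` in cell `i` of array `a`. -/
def Store.set (s : Store) (a i x : ℕ) : Store :=
  Function.update s a (Function.update (s a) i x)

/-- `Runs p s t s'`: started in memory `s`, the program `p` halts after exactly `t` steps in
memory `s'`. -/
inductive Runs : Prog → Store → ℕ → Store → Prop
  | skip (s : Store) : Runs Prog.skip s 1 s
  | assign (s : Store) (a : ℕ) (i e : Expr) :
      Runs (Prog.assign a i e) s (i.cost + e.cost + 1) (s.set a (i.eval s) (e.eval s))
  | seq {p q : Prog} {s s' s'' : Store} {t t' : ℕ} :
      Runs p s t s' → Runs q s' t' s'' → Runs (Prog.seq p q) s (t + t') s''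
  | condTrue {e : Expr} {p q : Prog} {s s' : Store} {t : ℕ} :
      e.eval s ≠ 0 → Runs p s t s' → Runs (Prog.cond e p q) s (e.cost + t + 1) s'
  | condFalse {e : Expr} {p q : Prog} {s s' : Store} {t : ℕ} :
      e.eval s = 0 → Runs q s t s' → Runs (Prog.cond e p q) s (e.cost + t + 1) s'
  | loopDone {e : Expr} {p : Prog} {s : Store} :
      e.eval s = 0 → Runs (Prog.loop e p) s (e.cost + 1) s
  | loopStep {e : Expr} {p : Prog} {s s' s'' : Store} {t t' : ℕ} :
      e.eval s ≠ 0 → Runs p s t s' → Runs (Prog.loop e p) s' t' s'' →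
      Runs (Prog.loop e p) s (e.cost + t + t' + 1) s''

/-- Started in memory `s`, the program halts within `B` steps and leaves the truth value of `P`
in cell `0` of array `0`. -/
def DecidesWithin (p : Prog) (s : Store) (P : Prop) (B : ℕ) : Prop :=
  ∃ t ≤ B, ∃ s' : Store, Runs p s t s' ∧ (P → s' 0 0 = 1) ∧ (¬ P → s' 0 0 = 0)

end RAM

/-- The letter of `Σ^k` with number `b < 2^(m * k)`: bit `i * m + a` of `b` says whether `a` belongs
to component `i`. -/
def letterOfNat (m k b : ℕ) : Fin k → Letter m :=
  fun i => {a | b.testBit ((i : ℕ) * m + (a : ℕ)) = true}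

open Classical in
/-- The input: array `0` holds the parameters, arrays `1`, `2`, `3` the nodes of `ψ` in postorder,
array `4` the accepting states and array `5` the transition table (row by row) of the automaton. All
other cells are `0`. -/
noncomputable def inputStore {m kT kL n : ℕ} (p : LTL m kT)
    (A : DFA (Fin kL → Letter m) (Fin n)) : RAM.Store
  | 0, j => [m, kL, kT, p.size, n, (A.start : ℕ)].getD j 0
  | 1, j => (p.postorder.getD j (0, 0, 0)).1
  | 2, j => (p.postorder.getD j (0, 0, 0)).2.1
  | 3, j => (p.postorder.getD j (0, 0, 0)).2.2
  | 4, j => if h : j < n then (if (⟨j, h⟩ : Fin n) ∈ A.accept then 1 else 0) else 0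
  | 5, j => if h : j / 2 ^ (m * kL) < n then
      (A.step ⟨j / 2 ^ (m * kL), h⟩ (letterOfNat m kL (j % 2 ^ (m * kL))) : ℕ) else 0
  | _, _ => 0

/-!
Some accepted word fails to represent a bad prefix exactly if there are `kL` traces that satisfy
`ψ` under all `kL ^ kT` assignments of traces to the trace variables and of which some prefix,
zipped, is accepted by the automaton. In a tableau graph with
`n * 2 ^ (kL * m + kL ^ kT * |ψ|)` nodes, each of which carries a state of the automaton, a letter
and the truth values of the subformulas under every assignment, such traces are the paths that
pass through an accepting state and are fair to the until formulas. They exist exactly if a fair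
lasso does, which the transitive closure of the graph reveals.

The algorithm is written in a small language in which one global number bounds every loop, so
that compiling it to the machine costs a factor polynomial in that number.
-/

/-! ### Linear temporal logic -/

theorem Trace.suffix_zero {m : ℕ} (t : Trace m) : t.suffix 0 = t :=
  funext fun _ => congrArg t (zero_add _)

theorem Trace.suffix_suffix {m : ℕ} (t : Trace m) (i j : ℕ) :
    (t.suffix i).suffix j = t.suffix (i + j) :=
  funext fun _ => congrArg t (add_assoc _ _ _).symm

namespace LTL

variable {m k : ℕ}

/-- The list of the subformulas, in the order of `postorder`. -/
def subs : LTL m k → List (LTL m k)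
  | atom a v => [atom a v]
  | neg p => p.subs ++ [neg p]
  | disj p q => p.subs ++ q.subs ++ [disj p q]
  | next p => p.subs ++ [next p]
  | untl p q => p.subs ++ q.subs ++ [untl p q]

/-- The triple by which `postorder` describes the root of the syntax tree. -/
def label : LTL m k → ℕ × ℕ × ℕ
  | atom a v => (0, (a : ℕ), (v : ℕ))
  | neg _ => (1, 0, 0)
  | disj _ _ => (2, 0, 0)
  | next _ => (3, 0, 0)
  | untl _ _ => (4, 0, 0)

theorem postorder_eq_map_label (p : LTL m k) : p.postorder = p.subs.map label := by
  induction p <;> simp_all [postorder, subs, label]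

@[simp] theorem length_subs (p : LTL m k) : p.subs.length = p.size := by
  induction p <;> simp_all [subs, size, add_assoc]

theorem size_pos (p : LTL m k) : 0 < p.size := by
  cases p <;> simp [size]

theorem subs_eq_append (p : LTL m k) : ∃ l, p.subs = l ++ [p] := by
  cases p
  case atom => exact ⟨[], rfl⟩
  all_goals exact ⟨_, rfl⟩

/-- The subformulas of `p` form a segment of the list `l` with its end, `p` itself, at position
`j`. -/
def EndsAt (l : List (LTL m k)) (p : LTL m k) (j : ℕ) : Prop :=
  ∃ l₁ l₂, l = l₁ ++ p.subs ++ l₂ ∧ j + 1 = l₁.length + p.size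

section EndsAt

variable {l l' : List (LTL m k)} {p q : LTL m k} {j : ℕ}

theorem EndsAt.append_right (h : EndsAt l p j) : EndsAt (l ++ l') p j := by
  obtain ⟨l₁, l₂, rfl, hj⟩ := h
  exact ⟨l₁, l₂ ++ l', by simp, hj⟩

theorem EndsAt.append_left (h : EndsAt l p j) : EndsAt (l' ++ l) p (l'.length + j) := by
  obtain ⟨l₁, l₂, rfl, hj⟩ := h
  exact ⟨l' ++ l₁, l₂, by simp, by rw [List.length_append]; omega⟩

theorem EndsAt.getElem? (h : EndsAt l p j) : l[j]? = some p := by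
  obtain ⟨l₁, l₂, rfl, hj⟩ := h
  obtain ⟨l₃, hp⟩ := p.subs_eq_append
  have hl : l₃.length + 1 = p.size := by rw [← length_subs, hp, List.length_append]; rfl
  rw [hp, List.append_assoc, ← List.append_assoc l₁, ← List.append_assoc l₁,
    show j = (l₁ ++ l₃).length by rw [List.length_append]; omega]
  simp

theorem EndsAt.neg (h : EndsAt l (neg p) j) : ∃ i, j = i + 1 ∧ EndsAt l p i := by
  obtain ⟨l₁, l₂, rfl, hj⟩ := h
  have := p.size_pos
  simp only [size] at hj
  exact ⟨j - 1, by omega, l₁, [p.neg] ++ l₂, by simp [subs], by omega⟩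

theorem EndsAt.next (h : EndsAt l (next p) j) : ∃ i, j = i + 1 ∧ EndsAt l p i := by
  obtain ⟨l₁, l₂, rfl, hj⟩ := h
  have := p.size_pos
  simp only [size] at hj
  exact ⟨j - 1, by omega, l₁, [p.next] ++ l₂, by simp [subs], by omega⟩

theorem EndsAt.disj (h : EndsAt l (disj p q) j) :
    ∃ i, j = i + q.size + 1 ∧ EndsAt l p i ∧ EndsAt l q (i + q.size) := by
  obtain ⟨l₁, l₂, rfl, hj⟩ := h
  have := p.size_pos
  simp only [size] at hj
  exact ⟨l₁.length + p.size - 1, by omega,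
    ⟨l₁, q.subs ++ [p.disj q] ++ l₂, by simp [subs], by omega⟩,
    ⟨l₁ ++ p.subs, [p.disj q] ++ l₂, by simp [subs], by simp; omega⟩⟩

theorem EndsAt.untl (h : EndsAt l (untl p q) j) :
    ∃ i, j = i + q.size + 1 ∧ EndsAt l p i ∧ EndsAt l q (i + q.size) := by
  obtain ⟨l₁, l₂, rfl, hj⟩ := h
  have := p.size_pos
  simp only [size] at hj
  exact ⟨l₁.length + p.size - 1, by omega,
    ⟨l₁, q.subs ++ [p.untl q] ++ l₂, by simp [subs], by omega⟩,
    ⟨l₁ ++ p.subs, [p.untl q] ++ l₂, by simp [subs], by simp; omega⟩⟩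

theorem endsAt_root (p : LTL m k) : EndsAt p.subs p (p.size - 1) :=
  ⟨[], [], by simp, by have := p.size_pos; simp; omega⟩

/-- Every formula in the list is preceded by its proper subformulas. -/
def SubsClosed (l : List (LTL m k)) : Prop := ∀ j p, l[j]? = some p → EndsAt l p j

theorem SubsClosed.append (h : SubsClosed l) (h' : SubsClosed l') : SubsClosed (l ++ l') := by
  intro j p hp
  rcases lt_or_ge j l.length with hj | hj
  · rw [List.getElem?_append_left hj] at hp
    exact (h j p hp).append_right
  · rw [List.getElem?_append_right hj] at hp
    simpa only [Nat.add_sub_cancel' hj] using (h' _ p hp).append_left (l' := l)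

theorem SubsClosed.snoc (h : SubsClosed l) (hp : p.subs = l ++ [p]) : SubsClosed p.subs := by
  intro j q hq
  rcases lt_or_ge j l.length with hj | hj
  · rw [hp, List.getElem?_append_left hj] at hq
    rw [hp]
    exact (h j q hq).append_right
  · obtain ⟨hj', rfl⟩ := List.getElem?_eq_some_iff.1 hq
    have hlen := congrArg List.length hp
    simp only [length_subs, List.length_append, List.length_singleton] at hlen hj'
    have hroot : p.subs[j] = p := by
      simp only [hp, show j = l.length by omega, List.getElem_concat_length]
    rw [hroot, show j = p.size - 1 by omega]
    exact p.endsAt_root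

theorem subsClosed_subs (p : LTL m k) : SubsClosed p.subs := by
  induction p with
  | atom a v => exact SubsClosed.snoc (l := []) (by simp [SubsClosed]) rfl
  | neg p ih => exact ih.snoc rfl
  | disj p q ihp ihq => exact (ihp.append ihq).snoc rfl
  | next p ih => exact ih.snoc rfl
  | untl p q ihp ihq => exact (ihp.append ihq).snoc rfl

end EndsAt

/-- From time `i` on, `P` holds until `Q` does. -/
def Until (P Q : ℕ → Prop) (i : ℕ) : Prop := ∃ d, Q (i + d) ∧ ∀ l < d, P (i + l)

theorem until_iff {P Q : ℕ → Prop} {i : ℕ} : Until P Q i ↔ Q i ∨ P i ∧ Until P Q (i + 1) := by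
  constructor
  · rintro ⟨_ | d, hQ, hP⟩
    · exact .inl hQ
    · exact .inr ⟨hP 0 d.succ_pos, d, by rwa [add_right_comm], fun l hl => by
        rw [add_right_comm]; exact hP (l + 1) (Nat.succ_lt_succ hl)⟩
  · rintro (hQ | ⟨hP, d, hQ, hP'⟩)
    · exact ⟨0, hQ, by simp⟩
    · refine ⟨d + 1, by rwa [← add_assoc, add_right_comm], fun l hl => ?_⟩
      rcases l with _ | l
      · exact hP
      · rw [← add_assoc, add_right_comm]
        exact hP' l (Nat.lt_of_succ_lt_succ hl)

theorem iff_until_of_frequently {P Q U : ℕ → Prop} (hU : ∀ i, U i ↔ Q i ∨ P i ∧ U (i + 1))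
    (hfair : ∃ᶠ i in Filter.atTop, U i → Q i) (i : ℕ) : U i ↔ Until P Q i := by
  constructor
  · intro h
    obtain ⟨j, hij, hj⟩ := Filter.frequently_atTop.1 hfair i
    induction hij using Nat.decreasingInduction with
    | self => exact until_iff.2 (.inl (hj h))
    | of_succ i _ ih => exact until_iff.2 (((hU i).1 h).imp_right fun h' => ⟨h'.1, ih h'.2⟩)
  · rintro ⟨d, hQ, hP⟩
    induction d generalizing i with
    | zero => exact (hU i).2 (.inl hQ)
    | succ d ih =>
      refine (hU i).2 (.inr ⟨hP 0 d.succ_pos, ih (i + 1) ?_ fun l hl => ?_⟩)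
      · rwa [add_right_comm]
      · rw [add_right_comm]
        exact hP (l + 1) (Nat.succ_lt_succ hl)

/-- Satisfaction of a formula at time `i`. -/
def SatAt (p : LTL m k) (ρ : Fin k → Trace m) (i : ℕ) : Prop := p.Sat fun v => (ρ v).suffix i

section SatAt

variable {p q : LTL m k} {ρ : Fin k → Trace m} {i : ℕ}

theorem satAt_zero : p.SatAt ρ 0 ↔ p.Sat ρ := by
  rw [SatAt, show (fun v => (ρ v).suffix 0) = ρ from funext fun v => (ρ v).suffix_zero]

theorem satAt_disj : (disj p q).SatAt ρ i ↔ p.SatAt ρ i ∨ q.SatAt ρ i := Iff.rfl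

theorem satAt_next : (next p).SatAt ρ i ↔ p.SatAt ρ (i + 1) := by
  simp only [SatAt, Sat, Trace.suffix_suffix]

theorem satAt_untl : (untl p q).SatAt ρ i ↔ Until (p.SatAt ρ) (q.SatAt ρ) i := by
  simp only [SatAt, Sat, Trace.suffix_suffix, Until]

end SatAt

end LTL

/-! ### Bad prefixes -/

namespace HyperLTL

theorem sat_univClosure {m : ℕ} (T : Set (Trace m)) : ∀ {k : ℕ} (φ : HyperLTL m k),
    Sat T (univClosure k φ) Fin.elim0 ↔
      ∀ ρ : Fin k → Trace m, (∀ v, ρ v ∈ T) → Sat T φ ρ := by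
  intro k
  induction k with
  | zero =>
    intro φ
    refine ⟨fun h ρ _ => ?_, fun h => h _ fun v => v.elim0⟩
    rwa [Subsingleton.elim ρ Fin.elim0]
  | succ k ih =>
    intro φ
    rw [univClosure, ih]
    refine ⟨fun h ρ hρ => ?_, fun h ρ hρ t ht => h _ fun v => ?_⟩
    · have := h (Fin.init ρ) (fun v => hρ _) (ρ (Fin.last k)) (hρ _)
      rwa [Fin.snoc_init_self] at this
    · refine Fin.lastCases ?_ (fun i => ?_) v
      · rwa [Fin.snoc_last]
      · rw [Fin.snoc_castSucc]
        exact hρ i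

theorem models_univ {m k : ℕ} (T : Set (Trace m)) (p : LTL m k) :
    Models T (univ p) ↔ ∀ ρ : Fin k → Trace m, (∀ v, ρ v ∈ T) → p.Sat ρ :=
  sat_univClosure T (qfree p)

end HyperLTL

/-- The prefix of length `t` of a tuple of traces, as a word of tuples. -/
def Trace.zipPrefix {m k : ℕ} (ρ : Fin k → Trace m) (t : ℕ) : List (Fin k → Letter m) :=
  (List.range t).map fun i v => ρ v i

theorem acceptsOnlyBadPrefixes_iff_unzip {m k : ℕ} {Q : Type} {A : DFA (Fin k → Letter m) Q}
    {φ : HyperLTL m 0} :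
    AcceptsOnlyBadPrefixes A φ ↔ ∀ w ∈ A.accepts, IsBadPrefix φ (unzip w) :=
  forall₂_congr fun _ _ => ⟨fun ⟨_, hT, h⟩ => h ▸ hT, fun h => ⟨_, h, rfl⟩⟩

theorem isSetPrefix_unzip_iff {m k : ℕ} {w : List (Fin k → Letter m)} {T : Set (Trace m)} :
    IsSetPrefix (unzip w) T ↔
      ∃ ρ : Fin k → Trace m, (∀ i, ρ i ∈ T) ∧ w = Trace.zipPrefix ρ w.length := by
  have hprefix (ρ : Fin k → Trace m) : w = Trace.zipPrefix ρ w.length ↔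
      ∀ i, IsTracePrefix (w.map fun v => v i) (ρ i) := by
    simp only [IsTracePrefix, List.ext_getElem_iff, Trace.zipPrefix, List.length_map,
      List.length_range, List.getElem_map, List.getElem_range, funext_iff, true_and]
    exact ⟨fun h i j hj => h j hj hj i, fun h j hj _ i => h i j hj⟩
  constructor
  · intro h
    choose ρ hρ hw using fun i => h _ ⟨i, rfl⟩
    exact ⟨ρ, hρ, (hprefix ρ).2 hw⟩
  · rintro ⟨ρ, hρ, hw⟩ _ ⟨i, rfl⟩
    exact ⟨ρ i, hρ i, (hprefix ρ).1 hw i⟩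

theorem acceptsOnlyBadPrefixes_iff {m kT kL : ℕ} {Q : Type} (A : DFA (Fin kL → Letter m) Q)
    (ψ : LTL m kT) : AcceptsOnlyBadPrefixes A (HyperLTL.univ ψ) ↔
      ¬ ∃ ρ : Fin kL → Trace m, (∃ t, Trace.zipPrefix ρ t ∈ A.accepts) ∧
        ∀ f : Fin kT → Fin kL, ψ.Sat (ρ ∘ f) := by
  simp only [acceptsOnlyBadPrefixes_iff_unzip, IsBadPrefix, isSetPrefix_unzip_iff,
    HyperLTL.models_univ]
  constructor
  · rintro h ⟨ρ, ⟨t, ht⟩, hρ⟩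
    refine h _ ht (Set.range ρ) ⟨ρ, fun i => ⟨i, rfl⟩, by simp [Trace.zipPrefix]⟩ fun τ hτ => ?_
    choose f hf using hτ
    exact funext hf ▸ hρ f
  · rintro h w hw T ⟨ρ, hρ, hwρ⟩ hT
    exact h ⟨ρ, ⟨w.length, hwρ ▸ hw⟩, fun f => hT _ fun v => hρ (f v)⟩

/-! ### Fair paths in finite graphs -/

section FairPath

open Filter Relation

variable {α ι : Type*} {E : α → α → Prop}

theorem exists_path_of_transGen {x y : α} (h : TransGen E x y) :
    ∃ (l : ℕ) (g : ℕ → α), g 0 = x ∧ g (l + 1) = y ∧ ∀ i ≤ l, E (g i) (g (i + 1)) := by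
  induction h using TransGen.head_induction_on with
  | @single x h =>
    refine ⟨0, fun i => Nat.casesOn i x fun _ => y, rfl, rfl, fun i hi => ?_⟩
    rwa [Nat.le_zero.1 hi]
  | @head x z h _ ih =>
    obtain ⟨l, g, rfl, hl, hg⟩ := ih
    refine ⟨l + 1, fun i => Nat.casesOn i x g, rfl, hl, fun i hi => ?_⟩
    rcases i with _ | i
    · exact h
    · exact hg i (Nat.le_of_succ_le_succ hi)

theorem exists_path_through {y : ℕ → α} (hy : ∀ i, TransGen E (y i) (y (i + 1))) :
    ∃ g : ℕ → α, g 0 = y 0 ∧ (∀ t, E (g t) (g (t + 1))) ∧ ∀ i, ∃ t, i ≤ t ∧ g t = y i := by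
  choose l p hp0 hpl hp using fun i => exists_path_of_transGen (hy i)
  -- `s t` is the number of the piece that the path traverses at time `t`, and the position in it.
  let s : ℕ → ℕ × ℕ := fun t =>
    t.rec (0, 0) fun _ c => if c.2 < l c.1 then (c.1, c.2 + 1) else (c.1 + 1, 0)
  have hs (t : ℕ) : s (t + 1) =
      if (s t).2 < l (s t).1 then ((s t).1, (s t).2 + 1) else ((s t).1 + 1, 0) := rfl
  have hle (t : ℕ) : (s t).2 ≤ l (s t).1 := by
    rcases t with _ | t
    · exact Nat.zero_le _
    · rw [hs]
      split_ifs with h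
      · exact h
      · exact Nat.zero_le _
  have hpiece {t i : ℕ} (h : s t = (i, 0)) : ∀ k ≤ l i, s (t + k) = (i, k) := by
    intro k
    induction k with
    | zero => exact fun _ => h
    | succ k ih =>
      intro hk
      rw [← add_assoc, hs, ih (by omega), if_pos (by exact hk)]
  have hstart (i : ℕ) : ∃ t, i ≤ t ∧ s t = (i, 0) := by
    induction i with
    | zero => exact ⟨0, le_rfl, rfl⟩
    | succ i ih =>
      obtain ⟨t, hit, ht⟩ := ih
      refine ⟨t + l i + 1, by omega, ?_⟩
      rw [hs, hpiece ht _ le_rfl, if_neg (lt_irrefl _)]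
  refine ⟨fun t => p (s t).1 (s t).2, hp0 0, fun t => ?_, fun i => ?_⟩
  · have hE := hp _ _ (hle t)
    change E _ (p (s (t + 1)).1 (s (t + 1)).2)
    rw [hs]
    split_ifs with h
    · exact hE
    · rw [hp0, ← hpl, ← (hle t).antisymm (not_lt.1 h)]
      exact hE
  · obtain ⟨t, hit, ht⟩ := hstart i
    exact ⟨t, hit, by simp only [ht, hp0]⟩

theorem exists_frequently_eq [Nonempty ι] [Countable ι] :
    ∃ h : ℕ → ι, ∀ c, ∃ᶠ i in atTop, h i = c := by
  obtain ⟨h, hh⟩ := exists_surjective_nat ι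
  refine ⟨fun i => h i.unpair.1, fun c => frequently_atTop.2 fun a => ?_⟩
  obtain ⟨j, rfl⟩ := hh c
  exact ⟨Nat.pair j a, Nat.right_le_pair j a, by simp only [Nat.unpair_pair]⟩

theorem exists_fair_path_of_transGen [Countable ι] {F : ι → α → Prop} {z y : α}
    (hzy : TransGen E z y) (hyy : TransGen E y y)
    (hF : ∀ c, ∃ w, TransGen E y w ∧ TransGen E w y ∧ F c w) :
    ∃ g : ℕ → α, g 0 = z ∧ (∀ t, E (g t) (g (t + 1))) ∧ ∀ c, ∃ᶠ t in atTop, F c (g t) := by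
  choose w hyw hwy hw using hF
  obtain ⟨h, hh⟩ := exists_frequently_eq (ι := Option ι)
  let u : Option ι → α := fun o => o.elim y w
  have hyu (o : Option ι) : TransGen E y (u o) := by cases o <;> [exact hyy; exact hyw _]
  have huy (o : Option ι) : TransGen E (u o) y := by cases o <;> [exact hyy; exact hwy _]
  obtain ⟨g, hg0, hg, hgu⟩ := exists_path_through (E := E)
    (y := fun i => Nat.casesOn i z fun i => u (h i)) fun i => by
      rcases i with _ | i
      · exact hzy.trans (hyu _)
      · exact (huy _).trans (hyu _)
  refine ⟨g, hg0, hg, fun c => frequently_atTop.2 fun a => ?_⟩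
  obtain ⟨i, hai, hi⟩ := frequently_atTop.1 (hh (some c)) a
  obtain ⟨t, hit, ht⟩ := hgu (i + 1)
  exact ⟨t, by omega, by simpa only [ht, hi] using (show F c (u (some c)) from hw c)⟩

theorem exists_transGen_of_fair_path [Finite α] {F : ι → α → Prop} {g : ℕ → α}
    (hg : ∀ t, E (g t) (g (t + 1))) (hF : ∀ c, ∃ᶠ t in atTop, F c (g t)) (i : ℕ) :
    ∃ y, TransGen E (g i) y ∧ TransGen E y y ∧
      ∀ c, ∃ w, TransGen E y w ∧ TransGen E w y ∧ F c w := by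
  have hlt {a b : ℕ} (h : a < b) : TransGen E (g a) (g b) :=
    Nat.rel_of_forall_rel_succ_of_lt (TransGen E) (fun t => .single (hg t)) h
  obtain ⟨y, hy⟩ := Finite.exists_infinite_fiber g
  have hnext (a : ℕ) : ∃ b > a, g b = y :=
    let ⟨b, hb, hab⟩ := (Set.infinite_coe_iff.1 hy).exists_gt a
    ⟨b, hab, hb⟩
  obtain ⟨a, hia, rfl⟩ := hnext i
  obtain ⟨b, hab, hba⟩ := hnext a
  refine ⟨g a, hlt hia, by simpa only [hba] using hlt hab, fun c => ?_⟩
  obtain ⟨j, haj, hj⟩ := frequently_atTop'.1 (hF c) a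
  obtain ⟨d, hjd, hda⟩ := hnext j
  exact ⟨g j, hlt haj, by simpa only [hda] using hlt hjd, hj⟩

theorem exists_path_iff_exists_reflTransGen {P : α → Prop} {Q : (ℕ → α) → Prop} {x : α}
    (hQ : ∀ g, Q (fun t => g (t + 1)) ↔ Q g) :
    (∃ g : ℕ → α, g 0 = x ∧ (∀ t, E (g t) (g (t + 1))) ∧ (∃ t, P (g t)) ∧ Q g) ↔
      ∃ z, ReflTransGen E x z ∧ P z ∧
        ∃ g : ℕ → α, g 0 = z ∧ (∀ t, E (g t) (g (t + 1))) ∧ Q g := by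
  constructor
  · rintro ⟨g, rfl, hg, ⟨t, ht⟩, hQg⟩
    refine ⟨g t, ?_, ht, fun i => g (t + i), rfl, fun i => hg _, ?_⟩
    · exact Nat.rel_of_forall_rel_succ_of_le (ReflTransGen E) (fun t => .single (hg t)) t.zero_le
    · clear ht
      induction t with
      | zero => simpa only [zero_add] using hQg
      | succ t ih => simpa only [add_right_comm, add_assoc] using (hQ fun i => g (t + i)).2 ih
  · rintro ⟨z, hxz, hz, g, rfl, hg, hQg⟩
    induction hxz using ReflTransGen.head_induction_on with
    | refl => exact ⟨g, rfl, hg, ⟨0, hz⟩, hQg⟩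
    | @head x y hxy _ ih =>
      obtain ⟨f, rfl, hf, ⟨t, ht⟩, hQf⟩ := ih
      refine ⟨fun i => Nat.casesOn i x f, rfl, fun i => ?_, ⟨t + 1, ht⟩, (hQ _).1 hQf⟩
      rcases i with _ | i
      · exact hxy
      · exact hf i

theorem exists_fair_path_iff [Finite α] [Countable ι] {F : ι → α → Prop} {P : α → Prop} {x : α} :
    (∃ g : ℕ → α, g 0 = x ∧ (∀ t, E (g t) (g (t + 1))) ∧ (∃ t, P (g t)) ∧
      ∀ c, ∃ᶠ t in atTop, F c (g t)) ↔
    ∃ z, ReflTransGen E x z ∧ P z ∧ ∃ y, TransGen E z y ∧ TransGen E y y ∧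
      ∀ c, ∃ w, TransGen E y w ∧ TransGen E w y ∧ F c w := by
  rw [exists_path_iff_exists_reflTransGen (Q := fun g => ∀ c, ∃ᶠ t in atTop, F c (g t)) fun g =>
    forall_congr' fun c => by
      rw [← frequently_map (m := (· + 1)) (P := fun t => F c (g t)), map_add_atTop_eq_nat]]
  refine exists_congr fun z => and_congr_right fun _ => and_congr_right fun _ => ⟨?_, ?_⟩
  · rintro ⟨g, rfl, hg, hF⟩
    exact exists_transGen_of_fair_path hg hF 0
  · rintro ⟨y, hzy, hyy, hF⟩
    exact exists_fair_path_of_transGen hzy hyy hF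

end FairPath

/-! ### The tableau of a formula as a finite graph -/

namespace Tableau

open Filter Relation

variable {m kT kL n : ℕ}

/-- The number of bits of a node that describe a letter and the truth values of the subformulas
under each of the `kL ^ kT` assignments of the components of `Σ ^ kL` to the trace variables. -/
def width (ψ : LTL m kT) (kL : ℕ) : ℕ := kL * m + kL ^ kT * ψ.size

/-- The number of nodes of the tableau for an automaton with `n` states: a node is
`q * 2 ^ width + b` where `q` is a state and the bits of `b` describe a letter and truth values. -/
def nodes (ψ : LTL m kT) (kL n : ℕ) : ℕ := n * 2 ^ width ψ kL

/-- The assignment of components to trace variables with number `f`. -/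
def decode (f : Fin (kL ^ kT)) : Fin kT → Fin kL := finFunctionFinEquiv.symm f

/-- The automaton state in a node. -/
def state (ψ : LTL m kT) (kL : ℕ) (x : Fin (nodes ψ kL n)) : Fin n :=
  ⟨x / 2 ^ width ψ kL, Nat.div_lt_of_lt_mul (x.2.trans_eq (mul_comm _ _))⟩

/-- The node `x` claims the subformula at position `j` under the assignment `f`. -/
def Holds (ψ : LTL m kT) (x : ℕ) (f : Fin (kL ^ kT)) (j : ℕ) : Prop :=
  x.testBit (kL * m + (f * ψ.size + j)) = true

/-- The claims of a node `x` and its successor `y` respect the semantics of the subformula `p` at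
position `j`. Its children are found from the positions in postorder. -/
def Consistent (ψ : LTL m kT) (x y : ℕ) (f : Fin (kL ^ kT)) (j : ℕ) : LTL m kT → Prop
  | .atom a v => Holds ψ x f j ↔ a ∈ letterOfNat m kL x (decode f v)
  | .neg _ => Holds ψ x f j ↔ ¬ Holds ψ x f (j - 1)
  | .disj _ q => Holds ψ x f j ↔ Holds ψ x f (j - 1 - q.size) ∨ Holds ψ x f (j - 1)
  | .next _ => Holds ψ x f j ↔ Holds ψ y f (j - 1)
  | .untl _ q => Holds ψ x f j ↔
      Holds ψ x f (j - 1) ∨ Holds ψ x f (j - 1 - q.size) ∧ Holds ψ y f j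

/-- The node `x` does not postpone an until formula at position `j`. -/
def Fulfilled (ψ : LTL m kT) (f : Fin (kL ^ kT)) (j x : ℕ) : Prop :=
  ∀ p q, ψ.subs[j]? = some (.untl p q) → Holds ψ x f j → Holds ψ x f (j - 1)

/-- The edges of the product of the tableau with the automaton. -/
def Edge (ψ : LTL m kT) (A : DFA (Fin kL → Letter m) (Fin n)) (x y : Fin (nodes ψ kL n)) : Prop :=
  A.step (state ψ kL x) (letterOfNat m kL x) = state ψ kL y ∧
    ∀ (f : Fin (kL ^ kT)) j p, ψ.subs[j]? = some p → Consistent ψ x y f j p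

/-- The initial nodes: they claim `ψ` itself under every assignment. -/
def Initial (ψ : LTL m kT) (A : DFA (Fin kL → Letter m) (Fin n)) (x : Fin (nodes ψ kL n)) : Prop :=
  state ψ kL x = A.start ∧ ∀ f : Fin (kL ^ kT), Holds ψ x f (ψ.size - 1)

/-- The claims of the node `x` are true at time `t` of the traces `ρ`. -/
def Correct (ψ : LTL m kT) (ρ : Fin kL → Trace m) (t x : ℕ) : Prop :=
  ∀ (f : Fin (kL ^ kT)) j p, ψ.subs[j]? = some p → (Holds ψ x f j ↔ p.SatAt (ρ ∘ decode f) t)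

theorem exists_node (ψ : LTL m kT) (q : Fin n) (σ : Fin kL → Letter m)
    (V : Fin (kL ^ kT) → Fin ψ.size → Prop) :
    ∃ x : Fin (nodes ψ kL n), state ψ kL x = q ∧ letterOfNat m kL x = σ ∧
      ∀ f (j : Fin ψ.size), Holds ψ x f j ↔ V f j := by
  classical
  let e : (Fin kL × Fin m) ⊕ (Fin (kL ^ kT) × Fin ψ.size) ≃ Fin (width ψ kL) :=
    (finProdFinEquiv.sumCongr finProdFinEquiv).trans finSumFinEquiv
  have hleft (v a) : (e (.inl (v, a)) : ℕ) = v * m + a :=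
    (add_comm _ _).trans (congrArg (· + (a : ℕ)) (mul_comm _ _))
  have hright (f j) : (e (.inr (f, j)) : ℕ) = kL * m + (f * ψ.size + j) :=
    congrArg (kL * m + ·) ((add_comm _ _).trans (congrArg (· + (j : ℕ)) (mul_comm _ _)))
  let B (i : Fin (width ψ kL)) : Prop := (e.symm i).elim (fun c => c.2 ∈ σ c.1) fun c => V c.1 c.2
  let b := Nat.ofBits fun i => decide (B i)
  have hb : b < 2 ^ width ψ kL := Nat.ofBits_lt_two_pow _
  have hx : 2 ^ width ψ kL * q + b < nodes ψ kL n := by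
    rw [nodes, mul_comm n]
    nlinarith [Nat.mul_le_mul_left (2 ^ width ψ kL) (Nat.succ_le_of_lt q.2)]
  have hbit (c) : (2 ^ width ψ kL * q + b).testBit (e c) = true ↔
      c.elim (fun c => c.2 ∈ σ c.1) fun c => V c.1 c.2 := by
    rw [Nat.testBit_two_pow_mul_add _ hb, if_pos (e c).2, Nat.testBit_ofBits_lt _ _ (e c).2,
      decide_eq_true_iff]
    simp only [B, Fin.eta, Equiv.symm_apply_apply]
  refine ⟨⟨_, hx⟩, Fin.ext ?_, funext fun v => Set.ext fun a => ?_, fun f j => ?_⟩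
  · exact (Nat.mul_add_div (by positivity) _ _).trans
      (by rw [Nat.div_eq_of_lt hb, add_zero])
  · have h := hbit (.inl (v, a))
    rw [hleft] at h
    exact h
  · have h := hbit (.inr (f, j))
    rw [hright] at h
    exact h

theorem lt_size_of_getElem? {ψ p : LTL m kT} {j : ℕ} (h : ψ.subs[j]? = some p) : j < ψ.size :=
  ψ.length_subs ▸ (List.getElem?_eq_some_iff.1 h).1

theorem exists_node_correct (ψ : LTL m kT) (q : Fin n) (ρ : Fin kL → Trace m) (t : ℕ) :
    ∃ x : Fin (nodes ψ kL n),
      state ψ kL x = q ∧ (letterOfNat m kL x = fun v => ρ v t) ∧ Correct ψ ρ t x := by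
  obtain ⟨x, hq, hσ, hV⟩ := exists_node ψ q (fun v => ρ v t)
    fun f j => ∃ p, ψ.subs[(j : ℕ)]? = some p ∧ p.SatAt (ρ ∘ decode f) t
  refine ⟨x, hq, hσ, fun f j p hp => (hV f ⟨j, lt_size_of_getElem? hp⟩).trans ?_⟩
  simp only [hp, Option.some.injEq, exists_eq_left']

section Correct

variable {ψ : LTL m kT}

theorem correct_of_fair {g : ℕ → ℕ}
    (hg : ∀ t (f : Fin (kL ^ kT)) j p, ψ.subs[j]? = some p →
      Consistent ψ (g t) (g (t + 1)) f j p)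
    (hF : ∀ (f : Fin (kL ^ kT)) (j : Fin ψ.size), ∃ᶠ t in atTop, Fulfilled ψ f j (g t)) (t : ℕ) :
    Correct ψ (fun v i => letterOfNat m kL (g i) v) t (g t) := by
  intro f j p hj
  have hends := ψ.subsClosed_subs
  induction p generalizing t j with
  | atom a v => exact hg t f j _ hj
  | neg p ih =>
    obtain ⟨i, rfl, hp⟩ := (hends _ _ hj).neg
    exact (hg t f _ _ hj).trans (not_congr (ih t i hp.getElem?))
  | next p ih =>
    obtain ⟨i, rfl, hp⟩ := (hends _ _ hj).next
    exact (hg t f _ _ hj).trans ((ih (t + 1) i hp.getElem?).trans LTL.satAt_next.symm)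
  | disj p q ihp ihq =>
    obtain ⟨i, rfl, hp, hq⟩ := (hends _ _ hj).disj
    have h := hg t f _ _ hj
    simp only [Consistent, Nat.add_sub_cancel] at h
    exact h.trans (or_congr (ihp t i hp.getElem?) (ihq t _ hq.getElem?))
  | untl p q ihp ihq =>
    obtain ⟨i, rfl, hp, hq⟩ := (hends _ _ hj).untl
    rw [LTL.satAt_untl]
    refine LTL.iff_until_of_frequently (U := fun t => Holds ψ (g t) f (i + q.size + 1))
      (fun t => ?_) ((hF f ⟨_, lt_size_of_getElem? hj⟩).mono fun t ht => ?_) t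
    · have h := hg t f _ _ hj
      simp only [Consistent, Nat.add_sub_cancel] at h
      exact h.trans (or_congr (ihq t _ hq.getElem?) (and_congr_left' (ihp t i hp.getElem?)))
    · exact fun h => (ihq t _ hq.getElem?).1 (ht p q hj h)

theorem Correct.consistent {ρ : Fin kL → Trace m} {t x y : ℕ} (hx : Correct ψ ρ t x)
    (hy : Correct ψ ρ (t + 1) y) (hσ : letterOfNat m kL x = fun v => ρ v t) (f : Fin (kL ^ kT))
    {j : ℕ} {p : LTL m kT} (hj : ψ.subs[j]? = some p) : Consistent ψ x y f j p := by
  have hends := ψ.subsClosed_subs _ _ hj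
  cases p with
  | atom a v =>
    rw [Consistent, hσ]
    exact hx f j _ hj
  | neg p =>
    obtain ⟨i, rfl, hp⟩ := hends.neg
    exact (hx f _ _ hj).trans (not_congr (hx f i p hp.getElem?).symm)
  | next p =>
    obtain ⟨i, rfl, hp⟩ := hends.next
    exact (hx f _ _ hj).trans (LTL.satAt_next.trans (hy f i p hp.getElem?).symm)
  | disj p q =>
    obtain ⟨i, rfl, hp, hq⟩ := hends.disj
    simp only [Consistent, Nat.add_sub_cancel, hx f _ _ hj, hx f _ _ hp.getElem?,
      hx f _ _ hq.getElem?, LTL.satAt_disj]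
  | untl p q =>
    obtain ⟨i, rfl, hp, hq⟩ := hends.untl
    simp only [Consistent, Nat.add_sub_cancel, hx f _ _ hj, hx f _ _ hp.getElem?,
      hx f _ _ hq.getElem?, hy f _ _ hj, LTL.satAt_untl]
    exact LTL.until_iff

theorem frequently_fulfilled {ρ : Fin kL → Trace m} {g : ℕ → ℕ}
    (hg : ∀ t, Correct ψ ρ t (g t)) (f : Fin (kL ^ kT)) (j : ℕ) :
    ∃ᶠ t in atTop, Fulfilled ψ f j (g t) := by
  refine frequently_atTop.2 fun t => ?_
  by_cases ht : Fulfilled ψ f j (g t)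
  · exact ⟨t, le_rfl, ht⟩
  · simp only [Fulfilled, not_forall] at ht
    obtain ⟨p, q, hj, hholds, -⟩ := ht
    obtain ⟨d, hd, -⟩ := LTL.satAt_untl.1 ((hg t f j _ hj).1 hholds)
    obtain ⟨i, rfl, -, hq⟩ := (ψ.subsClosed_subs _ _ hj).untl
    exact ⟨t + d, Nat.le_add_right _ _, fun _ _ _ _ => (hg _ f _ q hq.getElem?).2 hd⟩

end Correct

theorem evalFrom_map_range {σ Q : Type*} (A : DFA σ Q) (q : ℕ → Q) (a : ℕ → σ)
    (h : ∀ i, A.step (q i) (a i) = q (i + 1)) (t : ℕ) :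
    A.evalFrom (q 0) ((List.range t).map a) = q t := by
  induction t with
  | zero => rfl
  | succ t ih => rw [List.range_succ, List.map_append, DFA.evalFrom_of_append, ih]; exact h t

variable (ψ : LTL m kT) (A : DFA (Fin kL → Letter m) (Fin n))

theorem exists_fair_path_of_traces {ρ : Fin kL → Trace m} {t : ℕ}
    (ht : Trace.zipPrefix ρ t ∈ A.accepts) (hρ : ∀ f : Fin kT → Fin kL, ψ.Sat (ρ ∘ f)) :
    ∃ x, Initial ψ A x ∧ ∃ g : ℕ → Fin (nodes ψ kL n), g 0 = x ∧
      (∀ i, Edge ψ A (g i) (g (i + 1))) ∧ (∃ i, state ψ kL (g i) ∈ A.accept) ∧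
      ∀ c : Fin (kL ^ kT) × Fin ψ.size, ∃ᶠ i in atTop, Fulfilled ψ c.1 c.2 (g i) := by
  let q (i : ℕ) : Fin n := A.evalFrom A.start (Trace.zipPrefix ρ i)
  have hq (i) : A.step (q i) (fun v => ρ v i) = q (i + 1) := by
    simp only [q, Trace.zipPrefix, List.range_succ, List.map_append, DFA.evalFrom_of_append]
    rfl
  choose g hgq hgσ hg using fun i => exists_node_correct ψ (q i) ρ i
  refine ⟨g 0, ⟨hgq 0, fun f => ?_⟩, g, rfl, fun i => ⟨?_, fun f j p hj => ?_⟩, ⟨t, ?_⟩,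
    fun c => frequently_fulfilled hg c.1 c.2⟩
  · exact (hg 0 f _ ψ ψ.endsAt_root.getElem?).2 (LTL.satAt_zero.2 (hρ _))
  · rw [hgq, hgq, hgσ, hq]
  · exact (hg i).consistent (hg (i + 1)) (hgσ i) f hj
  · rw [hgq]
    exact ht

theorem exists_traces_of_fair_path {g : ℕ → Fin (nodes ψ kL n)} (h0 : Initial ψ A (g 0))
    (hg : ∀ i, Edge ψ A (g i) (g (i + 1))) (hacc : ∃ i, state ψ kL (g i) ∈ A.accept)
    (hF : ∀ c : Fin (kL ^ kT) × Fin ψ.size, ∃ᶠ i in atTop, Fulfilled ψ c.1 c.2 (g i)) :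
    ∃ ρ : Fin kL → Trace m, (∃ t, Trace.zipPrefix ρ t ∈ A.accepts) ∧
      ∀ f : Fin kT → Fin kL, ψ.Sat (ρ ∘ f) := by
  obtain ⟨t, ht⟩ := hacc
  refine ⟨fun v i => letterOfNat m kL (g i) v, ⟨t, ?_⟩, fun f => ?_⟩
  · have heval := evalFrom_map_range A (fun i => state ψ kL (g i)) (fun i => letterOfNat m kL (g i))
      (fun i => (hg i).1) t
    rw [h0.1] at heval
    exact (congrArg (· ∈ A.accept) heval).mpr ht
  · have hcorrect := correct_of_fair (g := fun i => g i) (fun i => (hg i).2)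
      (fun f j => hF (f, j)) 0 (finFunctionFinEquiv f) _ ψ ψ.endsAt_root.getElem?
    rw [LTL.satAt_zero, decode, Equiv.symm_apply_apply] at hcorrect
    exact hcorrect.1 (h0.2 _)

theorem acceptsOnlyBadPrefixes_iff_graph : AcceptsOnlyBadPrefixes A (HyperLTL.univ ψ) ↔
    ¬ ∃ x, Initial ψ A x ∧ ∃ z, ReflTransGen (Edge ψ A) x z ∧ state ψ kL z ∈ A.accept ∧
      ∃ y, TransGen (Edge ψ A) z y ∧ TransGen (Edge ψ A) y y ∧
        ∀ c : Fin (kL ^ kT) × Fin ψ.size, ∃ w, TransGen (Edge ψ A) y w ∧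
          TransGen (Edge ψ A) w y ∧ Fulfilled ψ c.1 c.2 w := by
  rw [acceptsOnlyBadPrefixes_iff]
  simp only [← exists_fair_path_iff (P := fun z : Fin (nodes ψ kL n) => state ψ kL z ∈ A.accept)
    (F := fun (c : Fin (kL ^ kT) × Fin ψ.size) (w : Fin (nodes ψ kL n)) => Fulfilled ψ c.1 c.2 w)]
  refine not_congr ⟨?_, ?_⟩
  · rintro ⟨ρ, ⟨t, ht⟩, hρ⟩
    exact exists_fair_path_of_traces ψ A ht hρ
  · rintro ⟨_, h0, g, rfl, hg, hacc, hF⟩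
    exact exists_traces_of_fair_path ψ A h0 hg hacc hF

end Tableau

/-! ### Transitive closures -/

section PathBelow

variable {V : ℕ} {E : Fin V → Fin V → Prop} {r : ℕ} {x y z : Fin V}

/-- `PathBelow E r x y`: there is a nonempty `E`-path from `x` to `y` all of whose inner vertices
are below `r`. The recursion is that of the Floyd–Warshall algorithm. -/
def PathBelow (E : Fin V → Fin V → Prop) : ℕ → Fin V → Fin V → Prop
  | 0, x, y => E x y
  | r + 1, x, y => PathBelow E r x y ∨ ∃ z : Fin V, z = r ∧ PathBelow E r x z ∧ PathBelow E r z y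

theorem PathBelow.transGen (h : PathBelow E r x y) : Relation.TransGen E x y := by
  induction r generalizing x y with
  | zero => exact .single h
  | succ r ih =>
    obtain h | ⟨z, -, hxz, hzy⟩ := h
    · exact ih h
    · exact (ih hxz).trans (ih hzy)

theorem PathBelow.of_edge (h : E x y) : ∀ r, PathBelow E r x y
  | 0 => h
  | r + 1 => .inl (of_edge h r)

theorem pathBelow_succ_self : PathBelow E (x + 1) x y ↔ PathBelow E x x y :=
  ⟨fun h => h.elim id fun ⟨_, hz, _, h⟩ => Fin.ext hz ▸ h, .inl⟩

theorem pathBelow_self_succ : PathBelow E (y + 1) x y ↔ PathBelow E y x y :=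
  ⟨fun h => h.elim id fun ⟨_, hz, h, _⟩ => Fin.ext hz ▸ h, .inl⟩

theorem PathBelow.trans (hy : (y : ℕ) < r) (hxy : PathBelow E r x y) (hyz : PathBelow E r y z) :
    PathBelow E r x z := by
  induction r generalizing x y z with
  | zero => omega
  | succ r ih =>
    obtain hlt | rfl := Nat.lt_succ_iff_lt_or_eq.1 hy
    · obtain hxy | ⟨u, hu, hxu, huy⟩ := hxy <;> obtain hyz | ⟨v, hv, hyv, hvz⟩ := hyz
      · exact .inl (ih hlt hxy hyz)
      · exact .inr ⟨v, hv, ih hlt hxy hyv, hvz⟩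
      · exact .inr ⟨u, hu, hxu, ih hlt huy hyz⟩
      · exact .inr ⟨u, hu, hxu, Fin.ext (hu.trans hv.symm) ▸ hvz⟩
    · exact .inr ⟨y, rfl, pathBelow_self_succ.1 hxy, pathBelow_succ_self.1 hyz⟩

theorem pathBelow_iff_transGen : PathBelow E V x y ↔ Relation.TransGen E x y := by
  refine ⟨PathBelow.transGen, fun h => ?_⟩
  induction h with
  | single h => exact .of_edge h V
  | tail _ h ih => exact .trans (Fin.is_lt _) ih (.of_edge h V)

end PathBelow

/-! ### A language of bounded loops and its compilation -/

namespace RAM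

/-- Total correctness with a time bound: started in `σ`, the program halts within `B` steps in a
memory satisfying `Q`. -/
def HaltsWithin (p : Prog) (σ : Store) (B : ℕ) (Q : Store → Prop) : Prop :=
  ∃ t ≤ B, ∃ σ', Runs p σ t σ' ∧ Q σ'

section HaltsWithin

variable {p q : Prog} {e : Expr} {σ : Store} {B B' : ℕ} {Q R : Store → Prop}

theorem HaltsWithin.mono (h : HaltsWithin p σ B Q) (hB : B ≤ B') (hQ : ∀ σ', Q σ' → R σ') :
    HaltsWithin p σ B' R := by
  obtain ⟨t, ht, σ', hr, hσ'⟩ := h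
  exact ⟨t, ht.trans hB, σ', hr, hQ σ' hσ'⟩

theorem haltsWithin_skip (h : Q σ) : HaltsWithin .skip σ 1 Q :=
  ⟨1, le_rfl, σ, .skip σ, h⟩

theorem haltsWithin_assign {a : ℕ} {i : Expr} (h : Q (σ.set a (i.eval σ) (e.eval σ)))
    (hB : i.cost + e.cost + 1 ≤ B) : HaltsWithin (.assign a i e) σ B Q :=
  ⟨_, hB, _, .assign σ a i e, h⟩

theorem HaltsWithin.seq (h : HaltsWithin p σ B R)
    (h' : ∀ σ', R σ' → HaltsWithin q σ' B' Q) : HaltsWithin (.seq p q) σ (B + B') Q := by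
  obtain ⟨t, ht, σ', hr, hσ'⟩ := h
  obtain ⟨t', ht', σ'', hr', hσ''⟩ := h' σ' hσ'
  exact ⟨t + t', by omega, σ'', .seq hr hr', hσ''⟩

theorem haltsWithin_cond (hp : e.eval σ ≠ 0 → HaltsWithin p σ B Q)
    (hq : e.eval σ = 0 → HaltsWithin q σ B' Q) :
    HaltsWithin (.cond e p q) σ (e.cost + (B + B') + 1) Q := by
  by_cases he : e.eval σ = 0
  · obtain ⟨t, ht, σ', hr, hσ'⟩ := hq he
    exact ⟨_, by omega, σ', .condFalse he hr, hσ'⟩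
  · obtain ⟨t, ht, σ', hr, hσ'⟩ := hp he
    exact ⟨_, by omega, σ', .condTrue he hr, hσ'⟩

theorem haltsWithin_loop {n : ℕ} (I : ℕ → Store → Prop)
    (he : ∀ i σ, I i σ → e.eval σ = n - i)
    (hp : ∀ i < n, ∀ σ, I i σ → HaltsWithin p σ B (I (i + 1))) {i : ℕ} (hi : i ≤ n)
    (h : I i σ) :
    HaltsWithin (.loop e p) σ ((n - i) * (B + e.cost + 1) + e.cost + 1) (I n) := by
  induction hi using Nat.decreasingInduction generalizing σ with
  | self => exact ⟨_, by simp, σ, .loopDone (by simp [he n σ h]), h⟩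
  | of_succ i hi ih =>
    obtain ⟨t, ht, σ', hr, hσ'⟩ := hp i hi σ h
    obtain ⟨t', ht', σ'', hr', hσ''⟩ := ih hσ'
    refine ⟨_, ?_, σ'', .loopStep (by rw [he i σ h]; omega) hr hr', hσ''⟩
    rw [show n - i = n - (i + 1) + 1 by omega, add_one_mul]
    omega

end HaltsWithin

@[simp] theorem Store.set_apply (s : Store) (a i x b j : ℕ) :
    s.set a i x b j = if b = a ∧ j = i then x else s b j := by
  by_cases hb : b = a
  · subst hb
    by_cases hj : j = i <;> simp [Store.set, hj]
  · simp [Store.set, hb]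

theorem Store.set_of_ne (s : Store) {a b : ℕ} (h : b ≠ a) (i x : ℕ) : s.set a i x b = s b := by
  simp [Store.set, h]

/-- A bound on the number of iterations of every loop of the language `Tm`, kept in array `7`. -/
def Store.cap (s : Store) : ℕ := s 7 0

/-- The machine expression for the content of register `r`; the registers form array `6`. -/
def reg (r : ℕ) : Expr := .read 6 (.const r)

/-- Runs `p` with the values `0, 1, …` in register `c`, as often as the value that `b` leaves in
register `c + 1` says, but at most `Store.cap` times. -/
def countedLoop (c : ℕ) (b p : Prog) : Prog :=
  .seq b <| .seq (.assign 6 (.const (c + 1))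
      (.monus (reg (c + 1)) (.monus (reg (c + 1)) (.read 7 (.const 0))))) <|
    .seq (.assign 6 (.const c) (.const 0)) <|
    .loop (.monus (reg (c + 1)) (reg c)) (.seq p (.assign 6 (.const c) (.plus (reg c) (.const 1))))

theorem haltsWithin_countedLoop {c n B B' C : ℕ} {b p : Prog} {σ : Store}
    (I : ℕ → Store → Prop)
    (hb : HaltsWithin b σ B fun σ' => σ'.cap = C ∧ σ' 6 (c + 1) = n ∧
      ∀ x, I 0 ((σ'.set 6 (c + 1) x).set 6 c 0))
    (hp : ∀ i < min n C, ∀ σ, σ 6 c = i → I i σ → HaltsWithin p σ B' fun σ' =>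
      σ' 6 c = i ∧ σ' 6 (c + 1) = σ 6 (c + 1) ∧ I (i + 1) (σ'.set 6 c (i + 1))) :
    HaltsWithin (countedLoop c b p) σ (B + C * (B' + 20) + 20) (I (min n C)) := by
  let J (i : ℕ) (σ : Store) : Prop := σ 6 c = i ∧ σ 6 (c + 1) = min n C ∧ I i σ
  let Q (σ σ' : Store) : Prop := σ' = σ.set 6 (c + 1) (min n C) ∧
    ∀ x, I 0 ((σ.set 6 (c + 1) x).set 6 c 0)
  have hset (σ : Store) (h : σ.cap = C ∧ σ 6 (c + 1) = n ∧
      ∀ x, I 0 ((σ.set 6 (c + 1) x).set 6 c 0)) :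
      HaltsWithin (.assign 6 (.const (c + 1))
        (.monus (reg (c + 1)) (.monus (reg (c + 1)) (.read 7 (.const 0))))) σ 10 (Q σ) := by
    refine haltsWithin_assign ⟨?_, h.2.2⟩ (by simp [Expr.cost, reg])
    simp only [Expr.eval, reg, h.2.1, show σ 7 0 = C from h.1]
    congr 1
    omega
  have hzero (σ σ' : Store) (h : Q σ σ') :
      HaltsWithin (.assign 6 (.const c) (.const 0)) σ' 3 (J 0) := by
    obtain ⟨rfl, h⟩ := h
    exact haltsWithin_assign ⟨by simp [Expr.eval], by simp [Expr.eval], h _⟩ (by simp [Expr.cost])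
  have hloop (σ : Store) (h : J 0 σ) := haltsWithin_loop (e := .monus (reg (c + 1)) (reg c))
    (p := .seq p (.assign 6 (.const c) (.plus (reg c) (.const 1)))) J
    (fun i σ h => by simp only [Expr.eval, reg, h.1, h.2.1])
    (fun i hi σ h => (hp i hi σ h.1 h.2.2).seq fun σ' h' =>
      haltsWithin_assign (by simpa [J, Expr.eval, reg, h'.1, h'.2.1, h.2.1] using h'.2.2)
        (by simp [Expr.cost, reg] : _ ≤ 6)) (Nat.zero_le _) h
  refine (hb.seq fun σ h => (hset σ h).seq fun σ' h' => (hzero σ σ' h').seq hloop).mono ?_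
    fun _ h => h.2.2
  have := Nat.mul_le_mul (min_le_right n C) (show B' + 12 ≤ B' + 20 by omega)
  simp only [Expr.cost, reg, tsub_zero]
  linarith

/-- Terms over a list of variables. `read` looks up a cell of an array other than the array `6` of
registers. `iter b t u` starts with `t` and applies `u` once for each `i` below `b`, but at most
`Store.cap` times; in `u`, variable `0` is `i` and variable `1` the current value. The term
`drop k t` is `t` with the variable `k` removed from the context. -/
inductive Tm : Type
  | const (n : ℕ) : Tm
  | var (i : ℕ) : Tm
  | read (a : ℕ) (t : Tm) : Tm
  | plus (t u : Tm) : Tm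
  | monus (t u : Tm) : Tm
  | ite (c t u : Tm) : Tm
  | iter (b t u : Tm) : Tm
  | drop (k : ℕ) (t : Tm) : Tm

/-- The machine memory `σ` holds the memory `s` outside of the registers and the values `e` in the
registers `l`, all of which are below `d`. -/
structure Represents (σ s : Store) (l e : List ℕ) (d : ℕ) : Prop where
  arrays : ∀ a, a ≠ 6 → σ a = s a
  vars : l.map (σ 6) = e
  lt : ∀ r ∈ l, r < d

/-- The memories `σ` and `σ'` differ at most in the registers from `d` on. -/
def AgreeBelow (d : ℕ) (σ σ' : Store) : Prop := ∀ a i, (a = 6 → i < d) → σ' a i = σ a i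

section Represents

variable {σ σ' σ'' s : Store} {l e : List ℕ} {d d' r x : ℕ}

theorem AgreeBelow.refl : AgreeBelow d σ σ := fun _ _ _ => rfl

theorem AgreeBelow.trans (h : AgreeBelow d σ σ') (h' : AgreeBelow d' σ' σ'') (hd : d ≤ d') :
    AgreeBelow d σ σ'' :=
  fun a i ha => (h' a i fun h => (ha h).trans_le hd).trans (h a i ha)

theorem AgreeBelow.set_register (h : AgreeBelow d σ σ') (hr : d ≤ r) :
    AgreeBelow d σ (σ'.set 6 r x) := by
  intro a i ha
  rw [Store.set_apply, if_neg, h a i ha]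
  rintro ⟨ha', rfl⟩
  exact (ha ha').not_ge hr

theorem AgreeBelow.cap (h : AgreeBelow d σ σ') : σ'.cap = σ.cap := h 7 0 (by omega)

theorem Represents.cap (h : Represents σ s l e d) : σ.cap = s.cap := by
  rw [Store.cap, h.arrays 7 (by decide), Store.cap]

theorem Represents.mono (h : Represents σ s l e d) (hσ : AgreeBelow d σ σ') (hd : d ≤ d') :
    Represents σ' s l e d' where
  arrays a ha := by
    rw [← h.arrays a ha]
    exact funext fun i => hσ a i fun h => absurd h ha
  vars := by
    rw [← h.vars]
    exact List.map_congr_left fun r hr => hσ 6 r fun _ => h.lt r hr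
  lt r hr := (h.lt r hr).trans_le hd

theorem Represents.cons (h : Represents σ s l e d) (hr : r < d) :
    Represents σ s (r :: l) (σ 6 r :: e) d where
  arrays := h.arrays
  vars := by simp [h.vars]
  lt := by simpa [hr] using h.lt

theorem Represents.of_cons (h : Represents σ s (r :: l) (x :: e) d) (hl : ∀ r ∈ l, r < d') :
    Represents σ s l e d' where
  arrays := h.arrays
  vars := (List.cons.inj h.vars).2
  lt := hl

theorem Represents.eraseIdx (h : Represents σ s l e d) (k : ℕ) :
    Represents σ s (l.eraseIdx k) (e.eraseIdx k) d where
  arrays := h.arrays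
  vars := by rw [← h.vars, List.eraseIdx_map]
  lt r hr := h.lt r (List.mem_of_mem_eraseIdx hr)

theorem Represents.set (h : Represents σ s l e d) {a i x : ℕ} (ha : a ≠ 6) :
    Represents (σ.set a i x) (s.set a i x) l e d where
  arrays b hb := by
    funext j
    rw [Store.set_apply, Store.set_apply, h.arrays b hb]
  vars := by rw [Store.set_of_ne _ ha.symm, h.vars]
  lt := h.lt

end Represents

namespace Tm

/-- The value of a term. -/
def eval (s : Store) : Tm → List ℕ → ℕ
  | const n, _ => n
  | var i, e => e.getD i 0
  | read a t, e => if a = 6 then 0 else s a (t.eval s e)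
  | plus t u, e => t.eval s e + u.eval s e
  | monus t u, e => t.eval s e - u.eval s e
  | ite c t u, e => if c.eval s e ≠ 0 then t.eval s e else u.eval s e
  | iter b t u, e =>
      Nat.rec (t.eval s e) (fun i x => u.eval s (i :: x :: e)) (min (b.eval s e) s.cap)
  | drop k t, e => t.eval s (e.eraseIdx k)

/-- The program that puts the value of a term into register `d`, the values of the variables being
in the registers `l`. -/
def compile : List ℕ → ℕ → Tm → Prog
  | _, d, const n => .assign 6 (.const d) (.const n)
  | l, d, var i => .assign 6 (.const d) ((l[i]?).elim (.const 0) reg)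
  | l, d, read a t => .seq (compile l d t)
      (.assign 6 (.const d) (if a = 6 then .const 0 else .read a (reg d)))
  | l, d, plus t u => .seq (compile l d t) <| .seq (compile l (d + 1) u)
      (.assign 6 (.const d) (.plus (reg d) (reg (d + 1))))
  | l, d, monus t u => .seq (compile l d t) <| .seq (compile l (d + 1) u)
      (.assign 6 (.const d) (.monus (reg d) (reg (d + 1))))
  | l, d, ite c t u => .seq (compile l d c) (.cond (reg d) (compile l d t) (compile l d u))
  | l, d, iter b t u => .seq (compile l d t) <| countedLoop (d + 1) (compile l (d + 2) b) <|
      .seq (compile ((d + 1) :: d :: l) (d + 3) u) (.assign 6 (.const d) (reg (d + 3)))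
  | l, d, drop k t => compile (l.eraseIdx k) d t

open Polynomial in
/-- A bound for the running time of the compiled term, as a polynomial in `Store.cap`. -/
noncomputable def cost : Tm → ℕ[X]
  | const _ => 10
  | var _ => 10
  | read _ t => t.cost + 10
  | plus t u => t.cost + u.cost + 10
  | monus t u => t.cost + u.cost + 10
  | ite c t u => c.cost + t.cost + u.cost + 10
  | iter b t u => t.cost + (b.cost + X * (u.cost + 30) + 20)
  | drop _ t => t.cost

/-- The program `p` puts `x` into register `d` within `B` steps, changing no cell besides the
registers from `d` on. -/
abbrev Computes (p : Prog) (σ : Store) (B d x : ℕ) : Prop :=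
  HaltsWithin p σ B fun σ' => σ' 6 d = x ∧ AgreeBelow d σ σ'

section Computes

variable {p q : Prog} {σ s : Store} {l e : List ℕ} {B B' d x y n : ℕ}

theorem computes_assign {f : Expr} (hf : f.eval σ = x) (hB : f.cost + 2 ≤ B) :
    Computes (.assign 6 (.const d) f) σ B d x :=
  haltsWithin_assign ⟨by simp [Expr.eval, hf], AgreeBelow.refl.set_register le_rfl⟩
    (by simp only [Expr.cost]; omega)

theorem Computes.binary {f : Expr → Expr → Expr} (hp : Computes p σ B d x)
    (hq : ∀ σ', AgreeBelow d σ σ' → Computes q σ' B' (d + 1) y)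
    (hf : ∀ σ', σ' 6 d = x → σ' 6 (d + 1) = y → (f (reg d) (reg (d + 1))).eval σ' = n)
    (hB : (f (reg d) (reg (d + 1))).cost ≤ 8) :
    Computes (.seq p <| .seq q (.assign 6 (.const d) (f (reg d) (reg (d + 1))))) σ
      (B + B' + 10) d n := by
  refine (hp.seq fun σ' ⟨hx, h⟩ => (hq σ' h).seq (B' := 10)
    (Q := fun τ => τ 6 d = n ∧ AgreeBelow d σ τ) fun σ'' ⟨hy, h'⟩ => ?_).mono (by omega)
    fun _ h => h
  have hx' : σ'' 6 d = x := (h' 6 d (by simp)).trans hx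
  exact (computes_assign (hf σ'' hx' hy) (by omega)).mono le_rfl fun τ ⟨hτ, h''⟩ =>
    ⟨hτ, (h.trans h' (Nat.le_succ d)).trans h'' le_rfl⟩

theorem Computes.assign {f : Expr} (hp : Computes p σ B d x)
    (hf : ∀ σ', AgreeBelow d σ σ' → σ' 6 d = x → f.eval σ' = n) (hB : f.cost ≤ 8) :
    Computes (.seq p (.assign 6 (.const d) f)) σ (B + 10) d n :=
  hp.seq fun σ' ⟨hx, h⟩ => (computes_assign (hf σ' h hx) (by omega)).mono le_rfl
    fun _ ⟨hn, h'⟩ => ⟨hn, h.trans h' le_rfl⟩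

theorem Computes.cond {c : Prog} {C : ℕ} (hc : Computes c σ C d n)
    (hp : ∀ σ', AgreeBelow d σ σ' → Computes p σ' B d x)
    (hq : ∀ σ', AgreeBelow d σ σ' → Computes q σ' B' d y) :
    Computes (.seq c (.cond (reg d) p q)) σ (C + (B + B' + 10)) d (if n ≠ 0 then x else y) := by
  refine (hc.seq fun σ' ⟨hn, h⟩ => haltsWithin_cond
    (fun hne => (hp σ' h).mono le_rfl fun τ ⟨hx, h'⟩ =>
      ⟨hx.trans (if_pos (hn ▸ hne)).symm, h.trans h' le_rfl⟩)
    fun h0 => (hq σ' h).mono le_rfl fun τ ⟨hy, h'⟩ =>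
      ⟨hy.trans (if_neg (not_not_intro (hn ▸ h0))).symm, h.trans h' le_rfl⟩).mono ?_ fun _ h => h
  simp only [reg, Expr.cost]
  omega

theorem computes_countedLoop {b : Prog} (f : ℕ → ℕ → ℕ) (hσ : Represents σ s l e d)
    (hx : σ 6 d = x)
    (hb : Computes b σ B (d + 2) n)
    (hp : ∀ (σ' : Store) (i x : ℕ), Represents σ' s ((d + 1) :: d :: l) (i :: x :: e) (d + 3) →
      Computes p σ' B' (d + 3) (f i x)) :
    Computes (countedLoop (d + 1) b (.seq p (.assign 6 (.const d) (reg (d + 3))))) σ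
      (B + s.cap * (B' + 30) + 20) d (Nat.rec x f (min n s.cap)) := by
  refine haltsWithin_countedLoop (B' := B' + 10)
    (fun i τ => τ 6 d = Nat.rec x f i ∧ AgreeBelow d σ τ) ?_ ?_
  · refine hb.mono le_rfl fun σ' ⟨hn, h⟩ => ⟨h.cap.trans hσ.cap, hn, fun y => ⟨?_, ?_⟩⟩
    · simpa [show d ≠ d + 1 + 1 by omega] using (h 6 d (by simp)).trans hx
    · exact ((AgreeBelow.refl.trans h (by omega)).set_register (by omega)).set_register (by omega)
  · rintro i - τ hi ⟨hd, h⟩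
    have hτ : Represents τ s ((d + 1) :: d :: l) (i :: Nat.rec x f i :: e) (d + 3) := by
      have := ((hσ.mono h (by omega : d ≤ d + 3)).cons (r := d) (by omega)).cons (r := d + 1)
        (by omega)
      rwa [hi, hd] at this
    refine (hp τ i _ hτ).seq fun τ' ⟨hx', h'⟩ => haltsWithin_assign ⟨?_, ?_, ?_, ?_⟩
      (by simp [Expr.cost, reg])
    · simpa [Expr.eval, hi] using h' 6 (d + 1) (by simp)
    · simpa [Expr.eval, show d + 1 + 1 ≠ d by omega] using h' 6 (d + 1 + 1) (by simp)
    · simp [Expr.eval, reg, hx']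
    · exact ((h.trans h' (by omega)).set_register le_rfl).set_register (by omega)

end Computes

theorem computes_compile (t : Tm) : ∀ {σ s : Store} {l e : List ℕ} {d : ℕ},
    Represents σ s l e d → Computes (t.compile l d) σ (t.cost.eval s.cap) d (t.eval s e) := by
  induction t with
  | const n => exact fun _ => computes_assign rfl (by simp [Expr.cost, cost])
  | var i =>
    intro σ s l e d h
    refine computes_assign ?_ ?_
    · rw [← h.vars]
      simp only [eval, List.getD_eq_getElem?_getD, List.getElem?_map]
      cases l[i]? <;> rfl
    · cases l[i]? <;> simp [Expr.cost, reg, cost]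
  | read a _ ih =>
    intro σ s l e d h
    refine ((ih h).assign (fun σ' hσ' hx => ?_) ?_).mono (by simp [cost]) fun _ h => h
    · by_cases ha : a = 6
      · simp [ha, Expr.eval, eval]
      · simp [ha, Expr.eval, eval, reg, hx, (h.mono hσ' le_rfl).arrays a ha]
    · split_ifs <;> simp [Expr.cost, reg]
  | plus t u iht ihu =>
    intro σ s l e d h
    exact ((iht h).binary (fun σ' hσ' => ihu (h.mono hσ' (Nat.le_succ d)))
      (fun σ' hx hy => by simp [Expr.eval, reg, eval, hx, hy])
      (by simp [Expr.cost, reg])).mono (by simp [cost]) fun _ h => h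
  | monus t u iht ihu =>
    intro σ s l e d h
    exact ((iht h).binary (fun σ' hσ' => ihu (h.mono hσ' (Nat.le_succ d)))
      (fun σ' hx hy => by simp [Expr.eval, reg, eval, hx, hy])
      (by simp [Expr.cost, reg])).mono (by simp [cost]) fun _ h => h
  | ite c t u ihc iht ihu =>
    intro σ s l e d h
    exact ((ihc h).cond (fun σ' hσ' => iht (h.mono hσ' le_rfl)) fun σ' hσ' =>
      ihu (h.mono hσ' le_rfl)).mono (by simp [cost, add_assoc]) fun _ h => h
  | iter b t u ihb iht ihu =>
    intro σ s l e d h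
    refine ((iht h).seq fun σ' ⟨hx, hσ'⟩ => (computes_countedLoop
      (fun i x => u.eval s (i :: x :: e)) (h.mono hσ' le_rfl) hx
      (ihb ((h.mono hσ' le_rfl).mono .refl (by omega))) fun _ _ _ hτ => ihu hτ).mono le_rfl
        fun τ ⟨hτ, h'⟩ => ⟨hτ, hσ'.trans h' le_rfl⟩).mono ?_ fun _ h => h
    simp [cost]
  | drop k _ ih => exact fun h => ih (h.eraseIdx k)

end Tm

/-- Statements: `set` stores a value in a cell (of an array other than `6` and `7`), `all b p` runs
`p` for each `i` below `b`, but at most `Store.cap` times, with variable `0` being `i`. -/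
inductive Stmt : Type
  | set (a : ℕ) (i v : Tm) : Stmt
  | seq (p q : Stmt) : Stmt
  | all (b : Tm) (p : Stmt) : Stmt

namespace Stmt

/-- The memory after the execution of a statement. -/
def exec : Stmt → List ℕ → Store → Store
  | set a i v, e, s => if a = 6 ∨ a = 7 then s else s.set a (i.eval s e) (v.eval s e)
  | seq p q, e, s => q.exec e (p.exec e s)
  | all b p, e, s => Nat.rec s (fun i s' => p.exec (i :: e) s') (min (b.eval s e) s.cap)

/-- The program for a statement, the values of the variables being in the registers `l`. -/
def compile : List ℕ → ℕ → Stmt → Prog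
  | l, d, set a i v => if a = 6 ∨ a = 7 then .skip else
      .seq (i.compile l d) <| .seq (v.compile l (d + 1)) (.assign a (reg d) (reg (d + 1)))
  | l, d, seq p q => .seq (compile l d p) (compile l d q)
  | l, d, all b p => countedLoop d (b.compile l (d + 1)) (compile (d :: l) (d + 2) p)

open Polynomial in
/-- A bound for the running time of the compiled statement, as a polynomial in `Store.cap`. -/
noncomputable def cost : Stmt → ℕ[X]
  | set _ i v => i.cost + v.cost + 10
  | seq p q => p.cost + q.cost
  | all b p => b.cost + X * (p.cost + 20) + 20

theorem exec_seven (p : Stmt) : ∀ (e : List ℕ) (s : Store), p.exec e s 7 = s 7 := by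
  induction p with
  | set a i v =>
    intro e s
    simp only [exec]
    split_ifs with h
    · rfl
    · exact Store.set_of_ne _ (by omega) _ _
  | seq p q ihp ihq => exact fun e s => (ihq e _).trans (ihp e s)
  | all b p ih =>
    intro e s
    simp only [exec]
    induction min (b.eval s e) s.cap with
    | zero => rfl
    | succ n hn => exact (ih _ _).trans hn

theorem cap_exec (p : Stmt) (e : List ℕ) (s : Store) : (p.exec e s).cap = s.cap :=
  congrFun (exec_seven p e s) 0

theorem haltsWithin_compile_all {b : Tm} {p : Stmt} {B d : ℕ} {σ s : Store} {l e : List ℕ}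
    (hp : ∀ (σ s' : Store) (i : ℕ), s'.cap = s.cap → Represents σ s' (d :: l) (i :: e) (d + 2) →
      HaltsWithin (p.compile (d :: l) (d + 2)) σ B fun σ' =>
        Represents σ' (p.exec (i :: e) s') (d :: l) (i :: e) (d + 2) ∧ ∀ r < d + 2, σ' 6 r = σ 6 r)
    (h : Represents σ s l e d) :
    HaltsWithin ((all b p).compile l d) σ (b.cost.eval s.cap + s.cap * (B + 20) + 20) fun σ' =>
      Represents σ' ((all b p).exec e s) l e d ∧ ∀ r < d, σ' 6 r = σ 6 r := by
  let run (i : ℕ) : Store := Nat.rec s (fun i s' => p.exec (i :: e) s') i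
  have hcap (i : ℕ) : (run i).cap = s.cap := by
    induction i with
    | zero => rfl
    | succ i ih => exact (cap_exec p _ _).trans ih
  refine haltsWithin_countedLoop
    (fun i τ => Represents τ (run i) l e d ∧ ∀ r < d, τ 6 r = σ 6 r) ?_ ?_
  · refine (b.computes_compile (h.mono .refl (Nat.le_succ d))).mono le_rfl fun σ' ⟨hn, hσ'⟩ =>
      ⟨hσ'.cap.trans h.cap, hn, fun x => ?_⟩
    have hx : AgreeBelow d σ ((σ'.set 6 (d + 1) x).set 6 d 0) :=
      ((AgreeBelow.refl.trans hσ' (Nat.le_succ d)).set_register (Nat.le_succ d)).set_register le_rfl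
    exact ⟨h.mono hx le_rfl, fun r hr => hx 6 r fun _ => hr⟩
  · rintro i - τ hi ⟨hτ, hr⟩
    have hτ' := (hτ.mono .refl (by omega : d ≤ d + 2)).cons (r := d) (by omega)
    rw [hi] at hτ'
    refine (hp τ (run i) i (hcap i) hτ').mono le_rfl fun τ' ⟨h', hr'⟩ =>
      ⟨(hr' d (by omega)).trans hi, hr' (d + 1) (by omega), ?_, fun r hrd => ?_⟩
    · exact (h'.of_cons hτ.lt).mono (AgreeBelow.refl.set_register le_rfl) le_rfl
    · rw [Store.set_apply, if_neg (by omega), hr' r (by omega), hr r hrd]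

theorem haltsWithin_compile (p : Stmt) : ∀ {σ s : Store} {l e : List ℕ} {d : ℕ},
    Represents σ s l e d → HaltsWithin (p.compile l d) σ (p.cost.eval s.cap)
      fun σ' => Represents σ' (p.exec e s) l e d ∧ ∀ r < d, σ' 6 r = σ 6 r := by
  induction p with
  | set a i v =>
    intro σ s l e d h
    by_cases ha : a = 6 ∨ a = 7
    · simp only [compile, exec, ha, if_true]
      refine (haltsWithin_skip ⟨h, fun _ _ => rfl⟩).mono ?_ fun _ h => h
      simp only [cost, Polynomial.eval_add, Polynomial.eval_ofNat]
      omega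
    simp only [compile, exec, ha, if_false]
    refine ((i.computes_compile h).seq (B' := v.cost.eval s.cap + 10) fun σ₁ ⟨hi, h₁⟩ =>
      (v.computes_compile (h.mono h₁ (Nat.le_succ d))).seq fun σ₂ ⟨hv, h₂⟩ =>
        haltsWithin_assign ?_ (by simp [Expr.cost, reg])).mono ?_ fun _ h => h
    · have hi' : σ₂ 6 d = i.eval s e := (h₂ 6 d (by simp)).trans hi
      have h' := h₁.trans h₂ (Nat.le_succ d)
      simp only [Expr.eval, reg, hi', hv]
      exact ⟨(h.mono h' le_rfl).set (by tauto), fun r hr => by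
        rw [Store.set_of_ne _ (by tauto), h' 6 r fun _ => hr]⟩
    · simp only [cost, Polynomial.eval_add, Polynomial.eval_ofNat]
      omega
  | seq p q ihp ihq =>
    intro σ s l e d h
    refine ((ihp h).seq fun σ' h' => (ihq h'.1).mono le_rfl fun τ hτ =>
      ⟨hτ.1, fun r hr => (hτ.2 r hr).trans (h'.2 r hr)⟩).mono ?_ fun _ h => h
    simp [cost, cap_exec]
  | all b p ih =>
    intro σ s l e d h
    refine (haltsWithin_compile_all (B := p.cost.eval s.cap) (fun τ s' i hC hτ => ?_) h).mono
      (by simp [cost]) fun _ h => h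
    rw [← hC]
    exact ih hτ

end Stmt

/-- The memory in which every loop is bounded by the value of `b`. -/
def Store.withCap (s : Store) (b : Tm) : Store := s.set 7 0 (b.eval s [])

@[simp] theorem Store.cap_withCap (s : Store) (b : Tm) : (s.withCap b).cap = b.eval s [] := by
  simp [cap, withCap]

/-- Computes larger and larger loop bounds, each with the loops bounded by its predecessor, before
executing a statement under the last bound. -/
def staged : List Tm → Stmt → Prog
  | [], p => p.compile [] 0
  | b :: l, p => .seq (b.compile [] 0) <| .seq (.assign 7 (.const 0) (reg 0)) (staged l p)

/-- All loop bounds computed by `staged` are at most `B`. -/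
def CapsLe (B : ℕ) : List Tm → Store → Prop
  | [], s => s.cap ≤ B
  | b :: l, s => s.cap ≤ B ∧ CapsLe B l (s.withCap b)

theorem monotone_polynomial_eval (p : Polynomial ℕ) : Monotone fun x => p.eval x := by
  intro x y h
  simp only [Polynomial.eval_eq_sum]
  exact Finset.sum_le_sum fun i _ => Nat.mul_le_mul_left _ (Nat.pow_le_pow_left h i)

theorem exists_haltsWithin_staged (l : List Tm) (p : Stmt) :
    ∃ f : Polynomial ℕ, ∀ (σ s : Store) (B : ℕ), Represents σ s [] [] 0 → CapsLe B l s →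
      HaltsWithin (staged l p) σ (f.eval B)
        fun σ' => Represents σ' (p.exec [] (l.foldl Store.withCap s)) [] [] 0 := by
  induction l with
  | nil =>
    exact ⟨p.cost, fun σ s B h hB => (p.haltsWithin_compile h).mono
      (monotone_polynomial_eval _ hB) fun _ h => h.1⟩
  | cons b l ih =>
    obtain ⟨f, hf⟩ := ih
    refine ⟨b.cost + (4 + f), fun σ s B h hB => ?_⟩
    refine ((b.computes_compile h).seq (B' := 4 + f.eval B) fun σ₁ ⟨hx, h₁⟩ =>
      HaltsWithin.seq (R := fun σ₂ => Represents σ₂ (s.withCap b) [] [] 0) ?_ fun σ₂ h₂ =>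
        hf σ₂ _ B h₂ hB.2).mono ?_ fun _ h => h
    · refine haltsWithin_assign ?_ (by simp [Expr.cost, reg])
      simpa [Expr.eval, reg, hx, Store.withCap] using (h.mono h₁ le_rfl).set (by decide : 7 ≠ 6)
    · simpa using monotone_polynomial_eval _ hB.1

/-! ### Arithmetic and bounded quantifiers -/

namespace Tm

/-- The term in a context with one more variable in front. -/
def up (t : Tm) : Tm := drop 0 t

/-- Negation of truth values: `0` is false and every other value is true. -/
def not (t : Tm) : Tm := ite t (const 0) (const 1)

/-- Conjunction of truth values. -/
def and (t u : Tm) : Tm := ite t u (const 0)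

/-- Disjunction of truth values. -/
def or (t u : Tm) : Tm := ite t (const 1) u

/-- Equivalence of truth values. -/
def iff (t u : Tm) : Tm := ite t u (not u)

/-- The truth value, `0` or `1`, of `t ≤ u`. -/
def le (t u : Tm) : Tm := not (monus t u)

/-- The truth value, `0` or `1`, of `t = u`. -/
def eq (t u : Tm) : Tm := not (plus (monus t u) (monus u t))

/-- Multiplication as repeated addition; correct if `t` is at most the loop bound. -/
def mul (t u : Tm) : Tm := iter t (const 0) (plus (var 1) u.up.up)

/-- Exponentiation as repeated multiplication; correct if `t` and `u` are at most the loop bound. -/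
def pow (t u : Tm) : Tm := iter u (const 1) (mul t.up.up (var 1))

/-- Division: the number of positive multiples of `u` that are at most `t`. -/
def div (t u : Tm) : Tm :=
  iter t (const 0) (plus (var 1) (le (mul (plus (var 1) (const 1)) u.up.up) t.up.up))

/-- The remainder of division. -/
def mod (t u : Tm) : Tm := monus t (mul (div t u) u)

/-- Bit number `u` of `t`. -/
def bit (t u : Tm) : Tm := mod (div t (pow (const 2) u)) (const 2)

/-- The truth value of `t` holding for all values of variable `0` below `b`. -/
def all (b t : Tm) : Tm := iter b (const 1) (and (drop 1 t) (var 1))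

/-- The truth value of `t` holding for some value of variable `0` below `b`. -/
def ex (b t : Tm) : Tm := iter b (const 0) (or (drop 1 t) (var 1))

/-- A term is true if its value is nonzero. -/
def IsTrue (s : Store) (e : List ℕ) (t : Tm) : Prop := t.eval s e ≠ 0

variable {s : Store} {e : List ℕ} {t u b : Tm} {i x y : ℕ}

@[simp] theorem eval_const : (const x).eval s e = x := rfl

@[simp] theorem eval_var_zero : (var 0).eval s (x :: e) = x := rfl

@[simp] theorem eval_var_one : (var 1).eval s (x :: y :: e) = y := rfl

@[simp] theorem eval_up : t.up.eval s (x :: e) = t.eval s e := rfl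

@[simp] theorem eval_plus : (plus t u).eval s e = t.eval s e + u.eval s e := rfl

@[simp] theorem eval_monus : (monus t u).eval s e = t.eval s e - u.eval s e := rfl

theorem eval_read {a : ℕ} (ha : a ≠ 6) : (read a t).eval s e = s a (t.eval s e) := if_neg ha

open Classical in
theorem eval_ite : (ite b t u).eval s e = if IsTrue s e b then t.eval s e else u.eval s e := by
  rw [eval, IsTrue]; congr

theorem isTrue_ite : IsTrue s e (ite b t u) ↔
    IsTrue s e b ∧ IsTrue s e t ∨ ¬ IsTrue s e b ∧ IsTrue s e u := by
  by_cases h : b.eval s e = 0 <;> simp [IsTrue, eval, h]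

@[simp] theorem isTrue_const : IsTrue s e (const x) ↔ x ≠ 0 := Iff.rfl

@[simp] theorem isTrue_not : IsTrue s e t.not ↔ ¬ IsTrue s e t := by simp [not, isTrue_ite]

@[simp] theorem isTrue_and : IsTrue s e (t.and u) ↔ IsTrue s e t ∧ IsTrue s e u := by
  simp [and, isTrue_ite]

@[simp] theorem isTrue_or : IsTrue s e (t.or u) ↔ IsTrue s e t ∨ IsTrue s e u := by
  by_cases h : IsTrue s e t <;> simp [or, isTrue_ite, h]

@[simp] theorem isTrue_iff : IsTrue s e (t.iff u) ↔ (IsTrue s e t ↔ IsTrue s e u) := by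
  by_cases h : IsTrue s e t <;> simp [iff, isTrue_ite, h]

@[simp] theorem isTrue_le : IsTrue s e (t.le u) ↔ t.eval s e ≤ u.eval s e := by
  rw [le, isTrue_not, IsTrue, eval_monus]; omega

@[simp] theorem isTrue_eq : IsTrue s e (t.eq u) ↔ t.eval s e = u.eval s e := by
  rw [eq, isTrue_not, IsTrue, eval_plus, eval_monus, eval_monus]; omega

theorem eval_le : (t.le u).eval s e = if t.eval s e ≤ u.eval s e then 1 else 0 := by
  have h := isTrue_le (s := s) (e := e) (t := t) (u := u)
  simp only [IsTrue, le, not, eval] at h ⊢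
  split_ifs <;> simp_all

theorem eval_iter (h : b.eval s e ≤ s.cap) : (iter b t u).eval s e =
    Nat.rec (t.eval s e) (fun i x => u.eval s (i :: x :: e)) (b.eval s e) := by
  rw [eval, min_eq_left h]

theorem eval_mul (h : t.eval s e ≤ s.cap) : (t.mul u).eval s e = t.eval s e * u.eval s e := by
  rw [mul, eval_iter h]
  induction t.eval s e with
  | zero => simp
  | succ n ih => rw [add_one_mul, ← ih]; rfl

theorem eval_pow (ht : t.eval s e ≤ s.cap) (hu : u.eval s e ≤ s.cap) :
    (t.pow u).eval s e = t.eval s e ^ u.eval s e := by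
  rw [pow, eval_iter hu]
  induction u.eval s e with
  | zero => simp
  | succ n ih => rw [pow_succ', ← ih]; exact eval_mul ht

theorem eval_div (ht : t.eval s e ≤ s.cap) (hu : 0 < u.eval s e) :
    (t.div u).eval s e = t.eval s e / u.eval s e := by
  rw [div, eval_iter ht]
  suffices H : ∀ n ≤ t.eval s e, Nat.rec 0 (fun i x => (plus (var 1)
      (le (mul (plus (var 1) (const 1)) u.up.up) t.up.up)).eval s (i :: x :: e)) n =
      min n (t.eval s e / u.eval s e) from
    (H _ le_rfl).trans (min_eq_right (Nat.div_le_self _ _))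
  intro n
  induction n with
  | zero => simp
  | succ n ih =>
    intro hn
    simp only [ih (by omega)]
    rw [eval_plus, eval_le, eval_mul (by simp; omega)]
    simp only [eval_plus, eval_var_one, eval_const, eval_up, ← Nat.le_div_iff_mul_le hu]
    split_ifs <;> omega

theorem eval_mod (ht : t.eval s e ≤ s.cap) (hu : 0 < u.eval s e) :
    (t.mod u).eval s e = t.eval s e % u.eval s e := by
  have h : (t.div u).eval s e ≤ s.cap := by
    rw [eval_div ht hu]; exact (Nat.div_le_self _ _).trans ht
  rw [mod, eval_monus, eval_mul h, eval_div ht hu, Nat.mod_eq_sub_div_mul]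

theorem isTrue_bit (h2 : 2 ≤ s.cap) (ht : t.eval s e ≤ s.cap) (hu : u.eval s e ≤ s.cap) :
    IsTrue s e (t.bit u) ↔ (t.eval s e).testBit (u.eval s e) = true := by
  have hp : (pow (const 2) u).eval s e = 2 ^ u.eval s e := eval_pow h2 hu
  have hd : (t.div (pow (const 2) u)).eval s e = t.eval s e / 2 ^ u.eval s e := by
    rw [eval_div ht (by rw [hp]; positivity), hp]
  rw [IsTrue, bit, eval_mod (by rw [hd]; exact (Nat.div_le_self _ _).trans ht) (by simp), hd,
    Nat.testBit_eq_decide_div_mod_eq, eval_const, decide_eq_true_eq]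
  omega

theorem isTrue_drop_one : IsTrue s (i :: x :: e) (drop 1 t) ↔ IsTrue s (i :: e) t := Iff.rfl

theorem isTrue_all (h : b.eval s e ≤ s.cap) :
    IsTrue s e (all b t) ↔ ∀ i < b.eval s e, IsTrue s (i :: e) t := by
  rw [IsTrue, all, eval_iter h]
  induction b.eval s e with
  | zero => simp
  | succ n ih =>
    rw [Nat.forall_lt_succ_right, ← ih, and_comm]
    exact isTrue_and.trans (and_congr_left' isTrue_drop_one)

theorem isTrue_ex (h : b.eval s e ≤ s.cap) :
    IsTrue s e (ex b t) ↔ ∃ i < b.eval s e, IsTrue s (i :: e) t := by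
  rw [IsTrue, ex, eval_iter h]
  induction b.eval s e with
  | zero => simp
  | succ n ih =>
    rw [Nat.exists_lt_succ_right, ← ih, or_comm]
    exact isTrue_or.trans (or_congr_left isTrue_drop_one)

end Tm

/-! ### Matrices -/

namespace Stmt

open Tm

theorem exec_set {a : ℕ} (h6 : a ≠ 6) (h7 : a ≠ 7) (i v : Tm) (e : List ℕ) (s : Store) :
    (set a i v).exec e s = s.set a (i.eval s e) (v.eval s e) := if_neg (by simp [h6, h7])

theorem exec_all {b : Tm} {p : Stmt} {e : List ℕ} {s : Store} {n : ℕ} (I : ℕ → Store → Prop)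
    (hb : b.eval s e = n) (hn : n ≤ s.cap) (h0 : I 0 s)
    (hp : ∀ i < n, ∀ s', I i s' → I (i + 1) (p.exec (i :: e) s')) : I n ((all b p).exec e s) := by
  rw [exec, hb, min_eq_left hn]
  suffices ∀ i ≤ n, I i (Nat.rec s (fun i s' => p.exec (i :: e) s') i) from this n le_rfl
  intro i hi
  induction i with
  | zero => exact h0
  | succ i ih => exact hp i hi _ (ih (Nat.le_of_succ_le hi))

end Stmt

/-- The memories `s` and `s'` agree outside array `a`. -/
def EqOff (a : ℕ) (s s' : Store) : Prop := ∀ b, b ≠ a → s' b = s b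

/-- The entry in row `x` and column `y` of the `V × V` matrix stored row by row in array `a`, read
as a truth value. -/
def Entry (a V : ℕ) (s : Store) (x y : Fin V) : Prop := s a (x * V + y) ≠ 0

/-- The term for an entry of the matrix with `V` rows stored in array `a`. -/
def Tm.entry (a : ℕ) (V x y : Tm) : Tm := read a (plus (mul x V) y)

/-- Sets the entries of the matrix with `V` rows in array `a`, row by row, to the values of `t`,
where variable `0` is the column and variable `1` the row. -/
def Stmt.setMatrix (a : ℕ) (V t : Tm) : Stmt :=
  all V (all V (set a (.plus (.mul (.var 1) V) (.var 0)) t))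

/-- Replaces the relation stored as a matrix by its transitive closure. -/
def Stmt.closeMatrix (a : ℕ) (V : Tm) : Stmt :=
  all V (setMatrix a V ((Tm.entry a V (.var 1) (.var 0)).or
    ((Tm.entry a V (.var 1) (.var 2)).and (Tm.entry a V (.var 2) (.var 0)))))

theorem EqOff.set {a : ℕ} {s s' : Store} (h : EqOff a s s') (i x : ℕ) : EqOff a s (s'.set a i x) :=
  fun b hb => (s'.set_of_ne hb i x).trans (h b hb)

theorem EqOff.cap {a : ℕ} {s s' : Store} (h : EqOff a s s') (ha : a ≠ 7) : s'.cap = s.cap :=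
  congrFun (h 7 ha.symm) 0

theorem entry_set {a V : ℕ} {s : Store} {x y x' y' : Fin V} {v : ℕ} :
    Entry a V (s.set a (x * V + y) v) x' y' ↔
      if x' = x ∧ y' = y then v ≠ 0 else Entry a V s x' y' := by
  have hinj : (x' * V + y' : ℕ) = x * V + y ↔ x' = x ∧ y' = y := by
    simpa [finProdFinEquiv, Fin.ext_iff, mul_comm, add_comm] using
      (finProdFinEquiv (m := V) (n := V)).apply_eq_iff_eq (x := (x', y')) (y := (x, y))
  simp only [Entry, Store.set_apply, true_and, hinj]
  split_ifs <;> rfl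

namespace Stmt

open Tm

variable {a n : ℕ} {V t : Tm} {s : Store} {e : List ℕ} {R R' : Fin n → Fin n → Prop}

theorem isTrue_entry {x y : Tm} {i j : Fin n} (ha : a ≠ 6) (hV : V.eval s e = n) (hn : n ≤ s.cap)
    (hx : x.eval s e = i) (hy : y.eval s e = j) :
    IsTrue s e (Tm.entry a V x y) ↔ Entry a n s i j := by
  rw [IsTrue, Tm.entry, eval_read ha, eval_plus, eval_mul (by omega), hx, hy, hV, Entry]

theorem exec_set_entry (h6 : a ≠ 6) (h7 : a ≠ 7) {i j : Fin n} (hn : n ≤ s.cap)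
    (hV : V.eval s (j :: i :: e) = n) :
    (set a (.plus (.mul (.var 1) V) (.var 0)) t).exec (j :: i :: e) s =
      s.set a (i * n + j) (t.eval s (j :: i :: e)) := by
  have hi := i.2
  rw [exec_set h6 h7, eval_plus, eval_mul (by rw [eval_var_one]; omega), hV, eval_var_one,
    eval_var_zero]

/-- A stage of the execution of `setMatrix`: the entries in front of row `r` and column `c` already
form `R'`, the others still form `R`. -/
def FilledUpTo (a : ℕ) (R R' : Fin n → Fin n → Prop) (r c : ℕ) (s : Store) : Prop :=
  ∀ i j : Fin n, if (i : ℕ) < r ∨ (i : ℕ) = r ∧ (j : ℕ) < c then Entry a n s i j ↔ R' i j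
    else Entry a n s i j ↔ R i j

theorem FilledUpTo.iff_or_iff {r c : ℕ} (h : FilledUpTo a R R' r c s) (i j : Fin n) :
    (Entry a n s i j ↔ R i j) ∨ (Entry a n s i j ↔ R' i j) := by
  have hij := h i j
  split_ifs at hij
  exacts [.inr hij, .inl hij]

theorem FilledUpTo.set {r c : Fin n} {v : ℕ} (h : FilledUpTo a R R' r c s) (hv : v ≠ 0 ↔ R' r c) :
    FilledUpTo a R R' r (c + 1) (s.set a (r * n + c) v) := by
  intro i j
  rw [entry_set]
  by_cases hp : i = r ∧ j = c
  · obtain ⟨rfl, rfl⟩ := hp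
    simpa using hv
  · have : (i : ℕ) < r ∨ (i : ℕ) = r ∧ (j : ℕ) < c + 1 ↔
        (i : ℕ) < r ∨ (i : ℕ) = r ∧ (j : ℕ) < c := by
      simp only [Fin.ext_iff] at hp; omega
    simpa only [if_neg hp, this] using h i j

theorem FilledUpTo.next_row {r : ℕ} (h : FilledUpTo a R R' r n s) :
    FilledUpTo a R R' (r + 1) 0 s := by
  intro i j
  have hj := j.2
  have : (i : ℕ) < r + 1 ∨ (i : ℕ) = r + 1 ∧ (j : ℕ) < 0 ↔
      (i : ℕ) < r ∨ (i : ℕ) = r ∧ (j : ℕ) < n := by omega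
  simpa only [this] using h i j

/-- As the matrix is overwritten in place, the value of `t` must not depend on which entries have
already changed. -/
theorem exec_setMatrix (h6 : a ≠ 6) (h7 : a ≠ 7) (hn : n ≤ s.cap)
    (hV : ∀ s' e', EqOff a s s' → V.eval s' e' = n) (hR : ∀ i j, Entry a n s i j ↔ R i j)
    (ht : ∀ s' (i j : Fin n), EqOff a s s' →
      (∀ k l, (Entry a n s' k l ↔ R k l) ∨ (Entry a n s' k l ↔ R' k l)) →
      (IsTrue s' (j :: i :: e) t ↔ R' i j)) :
    EqOff a s ((setMatrix a V t).exec e s) ∧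
      ∀ i j, Entry a n ((setMatrix a V t).exec e s) i j ↔ R' i j := by
  let I (r c : ℕ) (s' : Store) : Prop := EqOff a s s' ∧ FilledUpTo a R R' r c s'
  suffices I n 0 ((setMatrix a V t).exec e s) from
    ⟨this.1, fun i j => by simpa [i.2] using this.2 i j⟩
  refine exec_all (I · 0) (hV s e fun _ _ => rfl) hn ⟨fun _ _ => rfl, by simpa [FilledUpTo]⟩
    fun r hr s₁ h₁ => ?_
  suffices I r n ((all V (set a (.plus (.mul (.var 1) V) (.var 0)) t)).exec (r :: e) s₁) from
    ⟨this.1, this.2.next_row⟩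
  refine exec_all (I r) (hV s₁ _ h₁.1) (hn.trans (h₁.1.cap h7).ge) h₁ fun c hc s₂ ⟨hs₂, h₂⟩ => ?_
  rw [exec_set_entry (i := ⟨r, hr⟩) (j := ⟨c, hc⟩) h6 h7 (hn.trans (hs₂.cap h7).ge) (hV s₂ _ hs₂)]
  exact ⟨hs₂.set _ _, h₂.set (r := ⟨r, hr⟩) (c := ⟨c, hc⟩) (ht s₂ _ _ hs₂ h₂.iff_or_iff)⟩

theorem exec_closeMatrix (h6 : a ≠ 6) (h7 : a ≠ 7) (hn : n ≤ s.cap)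
    (hV : ∀ s' e', EqOff a s s' → V.eval s' e' = n) (hR : ∀ i j, Entry a n s i j ↔ R i j) :
    EqOff a s ((closeMatrix a V).exec e s) ∧
      ∀ i j, Entry a n ((closeMatrix a V).exec e s) i j ↔ Relation.TransGen R i j := by
  simp only [← pathBelow_iff_transGen]
  refine exec_all (fun r s' => EqOff a s s' ∧ ∀ i j, Entry a n s' i j ↔ PathBelow R r i j)
    (hV s e fun _ _ => rfl) hn ⟨fun _ _ => rfl, hR⟩ fun r hr s₁ ⟨hs₁, h₁⟩ => ?_
  have htrans {s₂ : Store} (h : EqOff a s₁ s₂) : EqOff a s s₂ := fun b hb =>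
    (h b hb).trans (hs₁ b hb)
  refine (exec_setMatrix (e := r :: e) (R' := PathBelow R (r + 1)) h6 h7
    (hn.trans (hs₁.cap h7).ge) (fun s' e' h => hV s' e' (htrans h)) h₁ fun s₂ i j hs₂ hR₂ =>
      ?_).imp_left htrans
  have hn₂ : n ≤ s₂.cap := hn.trans ((htrans hs₂).cap h7).ge
  have hentry {x y : Tm} {k l : Fin n} := isTrue_entry (e := j :: i :: r :: e) (x := x) (y := y)
    (i := k) (j := l) h6 (hV s₂ _ (htrans hs₂)) hn₂
  have hcol := hR₂ i ⟨r, hr⟩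
  have hrow := hR₂ ⟨r, hr⟩ j
  rw [pathBelow_self_succ (y := ⟨r, hr⟩), or_self] at hcol
  rw [pathBelow_succ_self (x := ⟨r, hr⟩), or_self] at hrow
  rw [isTrue_or, isTrue_and, hentry rfl rfl, hentry (k := i) (l := ⟨r, hr⟩) rfl rfl,
    hentry (k := ⟨r, hr⟩) (l := j) rfl rfl, hcol, hrow]
  have hsucc : PathBelow R (r + 1) i j ↔
      PathBelow R r i j ∨ PathBelow R r i ⟨r, hr⟩ ∧ PathBelow R r ⟨r, hr⟩ j :=
    or_congr_right ⟨fun ⟨_, hz, h⟩ => Fin.ext (a := _) (b := ⟨r, hr⟩) hz ▸ h, fun h => ⟨_, rfl, h⟩⟩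
  obtain h | h := hR₂ i j <;> rw [h, hsucc]
  tauto

end Stmt

end RAM

/-! ### The decision procedure -/

namespace BadPrefix

open RAM RAM.Tm

/-- The parameter number `i` of the input. -/
def input (i : ℕ) : Tm := .read 0 (.const i)

/-- The number of bits of a letter. -/
def letterBits : Tm := mul (input 1) (input 0)

/-- The number of assignments of components to trace variables. -/
def assignments : Tm := pow (input 1) (input 2)

/-- The term for `Tableau.width`. -/
def width : Tm := .plus letterBits (mul (input 3) assignments)

/-- The term for `Tableau.nodes`. -/
def nodes : Tm := mul (input 4) (pow (.const 2) width)

/-- The term for `Tableau.Holds`. -/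
def holds (x f j : Tm) : Tm := x.bit (.plus letterBits (.plus (mul f (input 3)) j))

/-- The term for `Tableau.decode`, for the assignment `f` and the trace variable `v`. -/
def digit (f v : Tm) : Tm := mod (div f (pow (input 1) v)) (input 1)

/-- The predecessor, which is the position of the right child or of the only one. -/
def pred (j : Tm) : Tm := .monus j (.const 1)

/-- The position of the left child of the node at position `j`. The sizes of the subformulas are in
array `9`. -/
def left (j : Tm) : Tm := .monus (pred j) (.read 9 (pred j))

/-- Is the node at position `j` of kind `i`? -/
def kind (j : Tm) (i : ℕ) : Tm := eq (.read 1 j) (.const i)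

/-- The size of the subformula at position `j`, from the sizes at smaller positions. -/
def size (j : Tm) : Tm :=
  .ite (kind j 0) (.const 1) <|
  .ite ((kind j 1).or (kind j 3)) (.plus (.read 9 (pred j)) (.const 1))
    (.plus (.plus (.read 9 (left j)) (.read 9 (pred j))) (.const 1))

/-- Does the atom at position `j` hold under the assignment `f` at the letter of the node `x`? -/
def atomHolds (x f j : Tm) : Tm :=
  x.bit (.plus (mul (digit f (.read 3 j)) (input 0)) (.read 2 j))

/-- The term for `Tableau.Consistent`. -/
def consistent (x y f j : Tm) : Tm :=
  .ite (kind j 0) ((holds x f j).iff (atomHolds x f j)) <|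
  .ite (kind j 1) ((holds x f j).iff (holds x f (pred j)).not) <|
  .ite (kind j 2) ((holds x f j).iff ((holds x f (left j)).or (holds x f (pred j)))) <|
  .ite (kind j 3) ((holds x f j).iff (holds y f (pred j)))
    ((holds x f j).iff ((holds x f (pred j)).or ((holds x f (left j)).and (holds y f j))))

/-- The term for `Tableau.Fulfilled`. -/
def fulfilled (x f j : Tm) : Tm :=
  (kind j 4).not.or ((holds x f j).not.or (holds x f (pred j)))

/-- The term for `Tableau.state`. -/
def state (x : Tm) : Tm := div x (pow (.const 2) width)

/-- The state reached from the node `x`, by the transition table in array `5`. -/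
def successor (x : Tm) : Tm :=
  .read 5 (.plus (mul (state x) (pow (.const 2) letterBits)) (mod x (pow (.const 2) letterBits)))

/-- The term for `Tableau.Edge`. -/
def edge (x y : Tm) : Tm :=
  (eq (successor x) (state y)).and <|
  all assignments <| all (input 3) <| consistent x.up.up y.up.up (.var 1) (.var 0)

/-- The term for `Tableau.Initial`. -/
def initial (x : Tm) : Tm :=
  (eq (state x) (input 5)).and (all assignments (holds x.up (.var 0) (pred (input 3))))

/-- Is `y` reachable from `x` by a nonempty path? This relation is the matrix in array `10`. -/
def reach (x y : Tm) : Tm := entry 10 nodes x y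

/-- Does the tableau have a fair path that starts in an initial node and meets an accepting state?
The shape of the term is that of `Tableau.acceptsOnlyBadPrefixes_iff_graph`. -/
def fairPath : Tm :=
  ex nodes <| (initial (.var 0)).and <|
  ex nodes <| ((eq (.var 0) (.var 1)).or (reach (.var 1) (.var 0))).and <|
    (Tm.read 4 (state (.var 0))).and <|
  ex nodes <| (reach (.var 1) (.var 0)).and <| (reach (.var 0) (.var 0)).and <|
  all assignments <| all (input 3) <|
  ex nodes <| (reach (.var 3) (.var 0)).and <| (reach (.var 0) (.var 3)).and <|
    fulfilled (.var 0) (.var 2) (.var 1)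

theorem letterOfNat_mod (m k b : ℕ) : letterOfNat m k (b % 2 ^ (m * k)) = letterOfNat m k b := by
  funext i
  ext a
  have : (i : ℕ) * m + a < m * k :=
    (mul_comm m k ▸ mul_comm m i ▸ Nat.mul_add_lt_mul_of_lt_of_lt i.2 a.2)
  simp only [letterOfNat, Set.mem_ofPred_eq, Nat.testBit_mod_two_pow, this, decide_true,
    Bool.true_and]

variable {m kT kL n : ℕ} {ψ : LTL m kT} {A : DFA (Fin kL → Letter m) (Fin n)} {s s' : Store}
  {e : List ℕ}

/-- The memory contains the input. -/
def HasInput (ψ : LTL m kT) (A : DFA (Fin kL → Letter m) (Fin n)) (s : Store) : Prop :=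
  ∀ a < 6, s a = inputStore ψ A a

namespace HasInput

theorem eqOff {a : ℕ} (h : HasInput ψ A s) (hs : EqOff a s s') (ha : 6 ≤ a) : HasInput ψ A s' :=
  fun b hb => (hs b (by omega)).trans (h b hb)

theorem eval_input (h : HasInput ψ A s) (i : ℕ) :
    (input i).eval s e = [m, kL, kT, ψ.size, n, (A.start : ℕ)].getD i 0 := by
  rw [input, eval_read (by decide), h 0 (by decide)]
  rfl

theorem eval_input_zero (h : HasInput ψ A s) : (input 0).eval s e = m := h.eval_input 0

theorem eval_input_one (h : HasInput ψ A s) : (input 1).eval s e = kL := h.eval_input 1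

theorem eval_input_two (h : HasInput ψ A s) : (input 2).eval s e = kT := h.eval_input 2

theorem eval_input_three (h : HasInput ψ A s) : (input 3).eval s e = ψ.size := h.eval_input 3

theorem eval_input_four (h : HasInput ψ A s) : (input 4).eval s e = n := h.eval_input 4

theorem eval_input_five (h : HasInput ψ A s) : (input 5).eval s e = A.start := h.eval_input 5

theorem read_label (h : HasInput ψ A s) {j : ℕ} {p : LTL m kT} (hj : ψ.subs[j]? = some p) :
    s 1 j = p.label.1 ∧ s 2 j = p.label.2.1 ∧ s 3 j = p.label.2.2 := by
  have key : ψ.postorder.getD j (0, 0, 0) = p.label := by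
    rw [LTL.postorder_eq_map_label, List.getD_eq_getElem?_getD, List.getElem?_map, hj]
    rfl
  rw [h 1 (by omega), h 2 (by omega), h 3 (by omega)]
  simp only [inputStore, key, and_self]

theorem kind_iff (h : HasInput ψ A s) {i : ℕ} {j : Tm} {p : LTL m kT}
    (hj : ψ.subs[j.eval s e]? = some p) : IsTrue s e (kind j i) ↔ p.label.1 = i := by
  rw [kind, isTrue_eq, eval_read (by decide), (h.read_label hj).1, eval_const]

theorem eval_letterBits (h : HasInput ψ A s) (hL : kL ≤ s.cap) :
    letterBits.eval s e = kL * m := by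
  rw [letterBits, eval_mul (by rwa [h.eval_input_one]), h.eval_input_one, h.eval_input_zero]

theorem eval_assignments (h : HasInput ψ A s) (hL : kL ≤ s.cap) (hT : kT ≤ s.cap) :
    assignments.eval s e = kL ^ kT := by
  rw [assignments, eval_pow (by rwa [h.eval_input_one]) (by rwa [h.eval_input_two]),
    h.eval_input_one, h.eval_input_two]

theorem eval_width (h : HasInput ψ A s) (hL : kL ≤ s.cap) (hT : kT ≤ s.cap)
    (hψ : ψ.size ≤ s.cap) : width.eval s e = Tableau.width ψ kL := by
  rw [width, eval_plus, eval_mul (by rwa [h.eval_input_three]), h.eval_letterBits hL,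
    h.eval_assignments hL hT, h.eval_input_three, Tableau.width, mul_comm ψ.size]

theorem eval_nodes (h : HasInput ψ A s) (h2 : 2 ≤ s.cap) (hn : n ≤ s.cap)
    (hwidth : width.eval s e = Tableau.width ψ kL) (hw : Tableau.width ψ kL ≤ s.cap) :
    nodes.eval s e = Tableau.nodes ψ kL n := by
  rw [nodes, eval_mul (by rwa [h.eval_input_four]), h.eval_input_four,
    eval_pow (by rwa [eval_const]) (by rwa [hwidth]), eval_const, hwidth, Tableau.nodes]

theorem eval_size (h : HasInput ψ A s) {tj : Tm} {p : LTL m kT}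
    (hp : ψ.subs[tj.eval s e]? = some p)
    (hs : ∀ i < tj.eval s e, ∀ q, ψ.subs[i]? = some q → s 9 i = q.size) :
    (size tj).eval s e = p.size := by
  have hend := ψ.subsClosed_subs _ _ hp
  have hread (i : Tm) : (Tm.read 9 i).eval s e = s 9 (i.eval s e) := rfl
  have hpred : (pred tj).eval s e = tj.eval s e - 1 := rfl
  have hleft : (left tj).eval s e = tj.eval s e - 1 - s 9 (tj.eval s e - 1) := rfl
  simp only [size, eval_ite, isTrue_or, h.kind_iff hp, eval_plus, eval_const, hread, hpred, hleft]
  cases p with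
  | atom a v => simp [LTL.label, LTL.size]
  | neg p =>
    obtain ⟨i, hj, hp⟩ := hend.neg
    have := hs i (by omega) _ hp.getElem?
    simp [LTL.label, LTL.size, hj, this]
  | next p =>
    obtain ⟨i, hj, hp⟩ := hend.next
    have := hs i (by omega) _ hp.getElem?
    simp [LTL.label, LTL.size, hj, this]
  | disj p q =>
    obtain ⟨i, hj, hp, hq⟩ := hend.disj
    have hl := hs i (by omega) _ hp.getElem?
    have hr := hs (i + q.size) (by omega) _ hq.getElem?
    simp [LTL.label, LTL.size, hj, hl, hr]
  | untl p q =>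
    obtain ⟨i, hj, hp, hq⟩ := hend.untl
    have hl := hs i (by omega) _ hp.getElem?
    have hr := hs (i + q.size) (by omega) _ hq.getElem?
    simp [LTL.label, LTL.size, hj, hl, hr]

end HasInput

/-- A bound for the number of iterations of every loop. -/
def bound (ψ : LTL m kT) (kL n : ℕ) : ℕ :=
  Tableau.nodes ψ kL n + (Tableau.width ψ kL + kL ^ kT + (m + kL + kT + ψ.size + n + 4))

/-- The memory contains the input and the sizes of the subformulas, and loops are long enough. -/
structure Ready (ψ : LTL m kT) (A : DFA (Fin kL → Letter m) (Fin n)) (s : Store) : Prop where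
  hasInput : HasInput ψ A s
  sizes : ∀ j p, ψ.subs[j]? = some p → s 9 j = p.size
  bound_le : bound ψ kL n ≤ s.cap

namespace Ready

theorem eqOff (h : Ready ψ A s) (hs : EqOff 10 s s') : Ready ψ A s' where
  hasInput := h.hasInput.eqOff hs (by decide)
  sizes j p hj := (congrFun (hs 9 (by decide)) j).trans (h.sizes j p hj)
  bound_le := h.bound_le.trans (hs.cap (by decide)).ge

theorem le_cap (h : Ready ψ A s) : Tableau.nodes ψ kL n ≤ s.cap ∧ Tableau.width ψ kL ≤ s.cap ∧
    kL ^ kT ≤ s.cap ∧ m + kL + kT + ψ.size + n + 4 ≤ s.cap := by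
  have := h.bound_le
  rw [bound] at this
  omega

theorem eval_letterBits (h : Ready ψ A s) : letterBits.eval s e = kL * m :=
  h.hasInput.eval_letterBits (by have := h.le_cap; omega)

theorem eval_assignments (h : Ready ψ A s) : assignments.eval s e = kL ^ kT :=
  h.hasInput.eval_assignments (by have := h.le_cap; omega) (by have := h.le_cap; omega)

theorem eval_width (h : Ready ψ A s) : width.eval s e = Tableau.width ψ kL := by
  obtain ⟨-, -, -, hi⟩ := h.le_cap
  exact h.hasInput.eval_width (by omega) (by omega) (by omega)

theorem eval_nodes (h : Ready ψ A s) : nodes.eval s e = Tableau.nodes ψ kL n := by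
  obtain ⟨-, hw, -, hi⟩ := h.le_cap
  exact h.hasInput.eval_nodes (by omega) (by omega) h.eval_width hw

section Terms

variable {tx ty tf tj : Tm} {x y : Fin (Tableau.nodes ψ kL n)} {f : Fin (kL ^ kT)} {j : ℕ}

theorem holds_iff (h : Ready ψ A s) (hx : tx.eval s e = x) (hf : tf.eval s e = f)
    (hj : tj.eval s e = j) (hlt : j < ψ.size) :
    IsTrue s e (holds tx tf tj) ↔ Tableau.Holds ψ x f j := by
  obtain ⟨hN, hw, hK, hi⟩ := h.le_cap
  have := x.2
  have hf' := f.2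
  have hindex : kL * m + (f * ψ.size + j) < Tableau.width ψ kL := by
    have := Nat.mul_add_lt_mul_of_lt_of_lt hf' hlt
    rw [Tableau.width, mul_comm (f : ℕ)]
    omega
  have heval : (Tm.plus letterBits (.plus (mul tf (input 3)) tj)).eval s e =
      kL * m + (f * ψ.size + j) := by
    rw [eval_plus, eval_plus, eval_mul (by omega), h.eval_letterBits, h.hasInput.eval_input_three,
      hf, hj]
  rw [holds, isTrue_bit (by omega) (by omega) (by omega), heval, hx, Tableau.Holds]

theorem eval_digit (h : Ready ψ A s) {tv : Tm} {v : Fin kT} (hf : tf.eval s e = f)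
    (hv : tv.eval s e = v) : (digit tf tv).eval s e = Tableau.decode f v := by
  obtain ⟨-, -, hK, hi⟩ := h.le_cap
  have hL : 0 < kL := (Tableau.decode f v).pos
  have hpow : (pow (input 1) tv).eval s e = kL ^ (v : ℕ) := by
    rw [eval_pow (by rw [h.hasInput.eval_input_one]; omega) (by omega),
      h.hasInput.eval_input_one, hv]
  have hdiv : (div tf (pow (input 1) tv)).eval s e = f / kL ^ (v : ℕ) := by
    rw [eval_div (by omega) (by rw [hpow]; positivity), hpow, hf]
  have := Nat.div_le_self f (kL ^ (v : ℕ))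
  rw [digit, eval_mod (by omega) (by rwa [h.hasInput.eval_input_one]), hdiv,
    h.hasInput.eval_input_one]
  rfl

theorem atomHolds_iff (h : Ready ψ A s) {a : Fin m} {v : Fin kT} (hx : tx.eval s e = x)
    (hf : tf.eval s e = f) (hp : ψ.subs[tj.eval s e]? = some (.atom a v)) :
    IsTrue s e (atomHolds tx tf tj) ↔ a ∈ letterOfNat m kL x (Tableau.decode f v) := by
  obtain ⟨hN, hw, -, hi⟩ := h.le_cap
  obtain ⟨-, ha, hv⟩ := h.hasInput.read_label hp
  have hdigit : (digit tf (.read 3 tj)).eval s e = Tableau.decode f v := h.eval_digit hf hv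
  have hindex : (Tableau.decode f v * m + a : ℕ) < kL * m := by
    rw [mul_comm _ m]
    exact Nat.mul_add_lt_mul_of_lt_of_lt (Tableau.decode f v).2 a.2
  have heval : (Tm.plus (mul (digit tf (.read 3 tj)) (input 0)) (.read 2 tj)).eval s e =
      Tableau.decode f v * m + a := by
    rw [eval_plus, eval_mul (by omega), hdigit, h.hasInput.eval_input_zero]
    exact congrArg _ ha
  have : kL * m ≤ Tableau.width ψ kL := Nat.le_add_right _ _
  rw [atomHolds, isTrue_bit (by omega) (by omega) (by omega), heval, hx]
  rfl

theorem consistent_iff (h : Ready ψ A s) {p : LTL m kT} (hx : tx.eval s e = x)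
    (hy : ty.eval s e = y) (hf : tf.eval s e = f) (hp : ψ.subs[tj.eval s e]? = some p) :
    IsTrue s e (consistent tx ty tf tj) ↔ Tableau.Consistent ψ x y f (tj.eval s e) p := by
  have hlt := Tableau.lt_size_of_getElem? hp
  have hend := ψ.subsClosed_subs _ _ hp
  have hholds {tx tj : Tm} {x : Fin (Tableau.nodes ψ kL n)} (hx : tx.eval s e = x)
      (hj : tj.eval s e < ψ.size) := h.holds_iff hx hf (Eq.refl (tj.eval s e)) hj
  have hpred : (pred tj).eval s e = tj.eval s e - 1 := rfl
  have hleft : (left tj).eval s e = tj.eval s e - 1 - s 9 (tj.eval s e - 1) := rfl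
  simp only [consistent, isTrue_ite, h.hasInput.kind_iff hp, isTrue_iff, isTrue_not, isTrue_or,
    isTrue_and, hholds hx hlt, hholds hy hlt, hholds (tj := pred tj) hx (by omega),
    hholds (tj := pred tj) hy (by omega), hholds (tj := left tj) hx (by omega), hleft, hpred,
    Tableau.Consistent]
  cases p with
  | atom a v => simp [LTL.label, h.atomHolds_iff hx hf hp]
  | neg p => simp [LTL.label]
  | next p => simp [LTL.label]
  | disj p q =>
    obtain ⟨i, hj, -, hq⟩ := hend.disj
    simp [LTL.label, hj, h.sizes _ _ hq.getElem?]
  | untl p q =>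
    obtain ⟨i, hj, -, hq⟩ := hend.untl
    simp [LTL.label, hj, h.sizes _ _ hq.getElem?]

theorem fulfilled_iff (h : Ready ψ A s) (hx : tx.eval s e = x) (hf : tf.eval s e = f)
    (hj : tj.eval s e = j) (hlt : j < ψ.size) :
    IsTrue s e (fulfilled tx tf tj) ↔ Tableau.Fulfilled ψ f j x := by
  obtain ⟨p, hp⟩ : ∃ p, ψ.subs[j]? = some p := ⟨_, List.getElem?_eq_getElem (by simpa using hlt)⟩
  have hpred : (pred tj).eval s e = j - 1 := congrArg (· - 1) hj
  rw [fulfilled, isTrue_or, isTrue_or, isTrue_not, isTrue_not,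
    h.hasInput.kind_iff (hj.symm ▸ hp), h.holds_iff hx hf hj hlt,
    h.holds_iff hx hf hpred (by omega), ← imp_iff_not_or, ← imp_iff_not_or, Tableau.Fulfilled, hp]
  cases p <;> simp [LTL.label]

theorem eval_state (h : Ready ψ A s) (hx : tx.eval s e = x) :
    (state tx).eval s e = Tableau.state ψ kL x := by
  obtain ⟨hN, hw, -, hi⟩ := h.le_cap
  have := x.2
  have hpow : (pow (.const 2) width).eval s e = 2 ^ Tableau.width ψ kL := by
    rw [eval_pow (by rw [eval_const]; omega) (by rwa [h.eval_width]), h.eval_width, eval_const]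
  rw [state, eval_div (by omega) (by rw [hpow]; positivity), hpow, hx, Tableau.state]

theorem eval_successor (h : Ready ψ A s) (hx : tx.eval s e = x) :
    (successor tx).eval s e = A.step (Tableau.state ψ kL x) (letterOfNat m kL x) := by
  obtain ⟨hN, hw, -, hi⟩ := h.le_cap
  have := x.2
  have hq := (Tableau.state ψ kL x).2
  have hpow : (pow (.const 2) letterBits).eval s e = 2 ^ (m * kL) := by
    have : kL * m ≤ Tableau.width ψ kL := Nat.le_add_right _ _
    rw [eval_pow (by rw [eval_const]; omega) (by rw [h.eval_letterBits]; omega),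
      h.eval_letterBits, eval_const, mul_comm]
  have hpos : 0 < 2 ^ (m * kL) := by positivity
  rw [successor, eval_read (by decide), h.hasInput 5 (by decide), eval_plus,
    eval_mul (by rw [h.eval_state hx]; omega), eval_mod (by omega) (by rwa [hpow]), hpow,
    h.eval_state hx, hx, mul_comm]
  simp only [inputStore, Nat.mul_add_div hpos, Nat.div_eq_of_lt (Nat.mod_lt _ hpos), add_zero,
    Nat.mul_add_mod, Nat.mod_mod, Fin.is_lt, dite_true, Fin.eta, letterOfNat_mod]

theorem isTrue_all_positions (h : Ready ψ A s) {t : Tm} {P : Fin (kL ^ kT) → Fin ψ.size → Prop}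
    (ht : ∀ (f : Fin (kL ^ kT)) (j : Fin ψ.size), IsTrue s (j :: f :: e) t ↔ P f j) :
    IsTrue s e (all assignments (all (input 3) t)) ↔ ∀ f j, P f j := by
  obtain ⟨-, -, hK, hi⟩ := h.le_cap
  rw [isTrue_all (by rwa [h.eval_assignments]), h.eval_assignments, Fin.forall_iff]
  refine forall₂_congr fun f hf => ?_
  rw [isTrue_all (by rw [h.hasInput.eval_input_three]; omega), h.hasInput.eval_input_three,
    Fin.forall_iff]
  exact forall₂_congr fun j hj => ht ⟨f, hf⟩ ⟨j, hj⟩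

theorem edge_iff (h : Ready ψ A s) (hx : tx.eval s e = x) (hy : ty.eval s e = y) :
    IsTrue s e (edge tx ty) ↔ Tableau.Edge ψ A x y := by
  rw [edge, isTrue_and, isTrue_eq, h.eval_successor hx, h.eval_state hy, Tableau.Edge, Fin.ext_iff,
    h.isTrue_all_positions fun f j => h.consistent_iff (x := x) (y := y) (f := f)
      (p := ψ.subs[j]'(by simp)) (by simpa) (by simpa) rfl (List.getElem?_eq_getElem _)]
  refine and_congr_right fun _ => forall_congr' fun f => ⟨fun H j p hp => ?_, fun H j =>
    H j _ (List.getElem?_eq_getElem _)⟩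
  obtain ⟨hj, rfl⟩ := List.getElem?_eq_some_iff.1 hp
  exact H ⟨j, by simpa using hj⟩

theorem initial_iff (h : Ready ψ A s) (hx : tx.eval s e = x) :
    IsTrue s e (initial tx) ↔ Tableau.Initial ψ A x := by
  obtain ⟨-, -, hK, -⟩ := h.le_cap
  have hroot {e : List ℕ} : (pred (input 3)).eval s e = ψ.size - 1 := by
    rw [pred, eval_monus, h.hasInput.eval_input_three, eval_const]
  have := ψ.size_pos
  rw [initial, isTrue_and, isTrue_eq, h.eval_state hx, h.hasInput.eval_input_five, Tableau.Initial,
    Fin.ext_iff, isTrue_all (by rwa [h.eval_assignments]), h.eval_assignments, Fin.forall_iff]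
  exact and_congr_right fun _ => forall₂_congr fun f hf =>
    h.holds_iff (f := ⟨f, hf⟩) (by simpa) rfl hroot (by omega)

theorem accept_iff (h : Ready ψ A s) (hx : tx.eval s e = x) :
    IsTrue s e (.read 4 (state tx)) ↔ Tableau.state ψ kL x ∈ A.accept := by
  rw [IsTrue, eval_read (by decide), h.eval_state hx, h.hasInput 4 (by decide)]
  simp [inputStore]

end Terms

theorem isTrue_ex_nodes (h : Ready ψ A s) {t : Tm} {P : Fin (Tableau.nodes ψ kL n) → Prop}
    (ht : ∀ x : Fin (Tableau.nodes ψ kL n), IsTrue s (x :: e) t ↔ P x) :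
    IsTrue s e (ex nodes t) ↔ ∃ x, P x := by
  rw [isTrue_ex (by rw [h.eval_nodes]; exact h.le_cap.1), h.eval_nodes, Fin.exists_iff]
  exact exists_congr fun i => ⟨fun ⟨hi, H⟩ => ⟨hi, (ht ⟨i, hi⟩).1 H⟩,
    fun ⟨hi, H⟩ => ⟨hi, (ht ⟨i, hi⟩).2 H⟩⟩

theorem fairPath_iff (h : Ready ψ A s)
    (hR : ∀ x y, Entry 10 (Tableau.nodes ψ kL n) s x y ↔
      Relation.TransGen (Tableau.Edge ψ A) x y) :
    IsTrue s [] fairPath ↔ ¬ AcceptsOnlyBadPrefixes A (HyperLTL.univ ψ) := by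
  have hreach {e : List ℕ} {tx ty : Tm} {x y : Fin (Tableau.nodes ψ kL n)}
      (hx : tx.eval s e = x) (hy : ty.eval s e = y) :
      IsTrue s e (reach tx ty) ↔ Relation.TransGen (Tableau.Edge ψ A) x y :=
    (Stmt.isTrue_entry (by decide) h.eval_nodes h.le_cap.1 hx hy).trans (hR x y)
  rw [Tableau.acceptsOnlyBadPrefixes_iff_graph, not_not, fairPath]
  refine h.isTrue_ex_nodes fun x => isTrue_and.trans <| and_congr (h.initial_iff rfl) <|
    h.isTrue_ex_nodes fun z => isTrue_and.trans <| and_congr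
      ((isTrue_or.trans <| or_congr (isTrue_eq.trans Fin.ext_iff.symm) (hreach rfl rfl)).trans
        Relation.reflTransGen_iff_eq_or_transGen.symm) <|
    isTrue_and.trans <| and_congr (h.accept_iff rfl) <|
    h.isTrue_ex_nodes fun y => isTrue_and.trans <| and_congr (hreach rfl rfl) <|
    isTrue_and.trans <| and_congr (hreach rfl rfl) ?_
  rw [Prod.forall]
  exact h.isTrue_all_positions fun f j => h.isTrue_ex_nodes fun w =>
    isTrue_and.trans <| and_congr (hreach rfl rfl) <| isTrue_and.trans <|
    and_congr (hreach rfl rfl) (h.fulfilled_iff rfl rfl rfl j.2)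

end Ready

/-- Fills array `9` with the sizes of the subformulas. -/
def sizes : Stmt := .all (input 3) (.set 9 (.var 0) (size (.var 0)))

/-- The sum of the parameters of the input, and room for constants. -/
def inputCap : Tm :=
  .plus (.plus (.plus (.plus (.plus (input 0) (input 1)) (input 2)) (input 3)) (input 4)) (.const 4)

/-- The number of bits of a node and the number of assignments, on top of `inputCap`. -/
def widthCap : Tm := .plus (.plus width assignments) inputCap

/-- The term for `bound`. -/
def nodesCap : Tm := .plus nodes widthCap

/-- The decision procedure under a loop bound of at least `bound`. The input is in the arrays `0` to
`5`; the sizes of the subformulas go to array `9`, the edges of the tableau and then their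
transitive closure to array `10`. -/
def search : Stmt :=
  .seq sizes <| .seq (.setMatrix 10 nodes (edge (.var 1) (.var 0))) <|
    .seq (.closeMatrix 10 nodes) <| .set 0 (.const 0) fairPath.not

/-- The algorithm. The number of nodes is not known before it is computed, and computing it takes
loops as well: the loops that compute one of the bounds are short enough for the preceding one. -/
def program : Prog := staged [inputCap, widthCap, nodesCap] search

namespace HasInput

theorem exec_sizes (h : HasInput ψ A s) (hψ : ψ.size ≤ s.cap) : EqOff 9 s (sizes.exec e s) ∧
    ∀ j p, ψ.subs[j]? = some p → sizes.exec e s 9 j = p.size := by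
  suffices EqOff 9 s (sizes.exec e s) ∧ ∀ j < ψ.size, ∀ p, ψ.subs[j]? = some p →
      sizes.exec e s 9 j = p.size from
    ⟨this.1, fun j p hp => this.2 j (Tableau.lt_size_of_getElem? hp) p hp⟩
  refine Stmt.exec_all (fun i s' => EqOff 9 s s' ∧ ∀ j < i, ∀ p, ψ.subs[j]? = some p →
    s' 9 j = p.size) h.eval_input_three hψ ⟨fun _ _ => rfl, by simp⟩ fun i _ s' ⟨hoff, hs'⟩ => ?_
  rw [Stmt.exec_set (by decide) (by decide)]
  refine ⟨hoff.set _ _, fun j hj p hp => ?_⟩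
  rw [Store.set_apply, eval_var_zero]
  split_ifs with hji
  · obtain rfl : j = i := hji.2
    exact (h.eqOff hoff (by decide)).eval_size hp hs'
  · exact hs' j (by omega) p hp

theorem withCap (h : HasInput ψ A s) (b : Tm) : HasInput ψ A (s.withCap b) :=
  fun a ha => (s.set_of_ne (by omega) _ _).trans (h a ha)

theorem eval_inputCap (h : HasInput ψ A s) :
    inputCap.eval s e = m + kL + kT + ψ.size + n + 4 := by
  simp only [inputCap, eval_plus, eval_const, h.eval_input_zero, h.eval_input_one,
    h.eval_input_two, h.eval_input_three, h.eval_input_four]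

theorem eval_widthCap (h : HasInput ψ A s) (hi : m + kL + kT + ψ.size + n + 4 ≤ s.cap) :
    widthCap.eval s e =
      Tableau.width ψ kL + kL ^ kT + (m + kL + kT + ψ.size + n + 4) := by
  rw [widthCap, eval_plus, eval_plus, h.eval_width (by omega) (by omega) (by omega),
    h.eval_assignments (by omega) (by omega), h.eval_inputCap]

theorem eval_nodesCap (h : HasInput ψ A s)
    (hw : Tableau.width ψ kL + kL ^ kT + (m + kL + kT + ψ.size + n + 4) ≤ s.cap) :
    nodesCap.eval s e = bound ψ kL n := by
  rw [nodesCap, eval_plus, h.eval_widthCap (by omega), h.eval_nodes (by omega) (by omega)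
    (h.eval_width (by omega) (by omega) (by omega)) (by omega), bound]

theorem exec_search (h : HasInput ψ A s) (hb : bound ψ kL n ≤ s.cap) :
    (AcceptsOnlyBadPrefixes A (HyperLTL.univ ψ) → search.exec [] s 0 0 = 1) ∧
      (¬ AcceptsOnlyBadPrefixes A (HyperLTL.univ ψ) → search.exec [] s 0 0 = 0) := by
  obtain ⟨hoff, hsizes⟩ := h.exec_sizes (e := []) (by rw [bound] at hb; omega)
  have ready : Ready ψ A (sizes.exec [] s) :=
    ⟨h.eqOff hoff (by decide), hsizes, hb.trans (hoff.cap (by decide)).ge⟩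
  obtain ⟨hoff, hedge⟩ := Stmt.exec_setMatrix (a := 10) (e := []) (t := edge (.var 1) (.var 0))
    (R' := Tableau.Edge ψ A) (by decide) (by decide) ready.le_cap.1
    (fun s' e' hs' => (ready.eqOff hs').eval_nodes) (fun _ _ => Iff.rfl)
    fun s' i j hs' _ => (ready.eqOff hs').edge_iff rfl rfl
  replace ready := ready.eqOff hoff
  obtain ⟨hoff, hpath⟩ := Stmt.exec_closeMatrix (e := []) (by decide) (by decide) ready.le_cap.1
    (fun s' e' hs' => (ready.eqOff hs').eval_nodes) hedge
  have hfair := (ready.eqOff hoff).fairPath_iff hpath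
  rw [search, Stmt.exec, Stmt.exec, Stmt.exec, Stmt.exec_set (by decide) (by decide),
    Store.set_apply, if_pos ⟨rfl, by simp⟩, Tm.not, eval_ite, hfair]
  exact ⟨fun hA => if_neg (not_not_intro hA), fun hA => if_pos hA⟩

end HasInput

theorem exists_decidesWithin : ∃ f : Polynomial ℕ, ∀ {m kT kL n : ℕ} (ψ : LTL m kT)
    (A : DFA (Fin kL → Letter m) (Fin n)), DecidesWithin program (inputStore ψ A)
      (AcceptsOnlyBadPrefixes A (HyperLTL.univ ψ)) (f.eval (bound ψ kL n)) := by
  obtain ⟨f, hf⟩ := exists_haltsWithin_staged [inputCap, widthCap, nodesCap] search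
  refine ⟨f, fun {m kT kL n} ψ A => ?_⟩
  have h₀ : HasInput ψ A (inputStore ψ A) := fun _ _ => rfl
  have h₁ := h₀.withCap inputCap
  have h₂ := h₁.withCap widthCap
  have h₃ := h₂.withCap nodesCap
  have cap₁ := h₀.eval_inputCap (e := [])
  rw [← Store.cap_withCap] at cap₁
  have cap₂ := h₁.eval_widthCap (e := []) cap₁.ge
  rw [← Store.cap_withCap] at cap₂
  have cap₃ := h₂.eval_nodesCap (e := []) cap₂.ge
  rw [← Store.cap_withCap] at cap₃
  have hcaps : CapsLe (bound ψ kL n) [inputCap, widthCap, nodesCap] (inputStore ψ A) := by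
    have : bound ψ kL n = Tableau.nodes ψ kL n + (Tableau.width ψ kL + kL ^ kT +
      (m + kL + kT + ψ.size + n + 4)) := rfl
    refine ⟨Nat.zero_le _, ?_, ?_, cap₃.le⟩ <;> omega
  obtain ⟨t, ht, σ, hrun, hσ⟩ := hf _ _ _ ⟨fun _ _ => rfl, rfl, by simp⟩ hcaps
  refine ⟨t, ht, σ, hrun, ?_⟩
  rw [hσ.arrays 0 (by decide)]
  exact h₃.exec_search cap₃.ge

/-! ### The running time -/

theorem eval_le_eval_one_mul_pow (p : Polynomial ℕ) {x : ℕ} (hx : 1 ≤ x) :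
    p.eval x ≤ p.eval 1 * x ^ p.natDegree := by
  simp only [Polynomial.eval_eq_sum_range, one_pow, mul_one, Finset.sum_mul]
  exact Finset.sum_le_sum fun i hi => Nat.mul_le_mul_left _ <|
    Nat.pow_le_pow_right hx (Nat.lt_succ_iff.1 (Finset.mem_range.1 hi))

theorem pow_le_two_pow_mul (a b : ℕ) : a ^ b ≤ 2 ^ (a * b) := by
  rw [pow_mul]
  exact Nat.pow_le_pow_left Nat.lt_two_pow_self.le b

theorem bound_le_mul_two_pow (ψ : LTL m kT) (kL : ℕ) (hn : 0 < n) :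
    bound ψ kL n ≤
      n * 2 ^ (Tableau.width ψ kL + kL ^ kT + (m + kL + kT + ψ.size + 4) + 1) := by
  set y := Tableau.width ψ kL + kL ^ kT + (m + kL + kT + ψ.size + 4) with hy
  have hy2 : y + 1 ≤ 2 ^ y := Nat.lt_two_pow_self
  have hw : 2 ^ Tableau.width ψ kL ≤ 2 ^ y := Nat.pow_le_pow_right two_pos (by omega)
  calc bound ψ kL n = n * 2 ^ Tableau.width ψ kL + (n + y) := by
        rw [bound, Tableau.nodes, hy]; ring
    _ ≤ n * 2 ^ y + n * 2 ^ y := by gcongr; nlinarith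
    _ = n * 2 ^ (y + 1) := by ring

theorem bound_le (ψ : LTL m kT) (kL : ℕ) (hn : 0 < n) : bound ψ kL n ≤
    n * 2 ^ (ψ.size * 2 ^ (max kT kL ^ 2 + (m + 2) * max kT kL + (m + 8))) := by
  set M := max kT kL
  have hT : kT ≤ M := le_max_left _ _
  have hL : kL ≤ M := le_max_right _ _
  set N := ψ.size
  have hN : 1 ≤ N := ψ.size_pos
  obtain ⟨Y, hY⟩ : ∃ Y, Y = M ^ 2 + (m + 2) * M + (m + 6) := ⟨_, rfl⟩
  have hpow : kL ^ kT ≤ 2 ^ Y := (pow_le_two_pow_mul _ _).trans <|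
    Nat.pow_le_pow_right two_pos (by nlinarith)
  have hlin : M * m + m + M + M + 5 + 1 ≤ 2 ^ Y :=
    le_trans (by rw [hY]; nlinarith) Nat.lt_two_pow_self.le
  refine (bound_le_mul_two_pow ψ kL hn).trans <| Nat.mul_le_mul_left _ <|
    Nat.pow_le_pow_right two_pos ?_
  calc Tableau.width ψ kL + kL ^ kT + (m + kL + kT + N + 4) + 1
      = kL ^ kT * N + (kL ^ kT + (kL * m + m + kL + kT + 5 + N)) := by rw [Tableau.width]; ring
    _ ≤ 2 ^ Y * N + (2 ^ Y * N + (M * m + m + M + M + 5 + 1) * N) := by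
        gcongr
        · exact hpow.trans (Nat.le_mul_of_pos_right _ hN)
        · rw [add_mul, one_mul]
          gcongr
          exact le_trans (by gcongr) (Nat.le_mul_of_pos_right _ hN)
    _ ≤ 2 ^ Y * N + (2 ^ Y * N + 2 ^ Y * N) := by gcongr
    _ ≤ 4 * (2 ^ Y * N) := by omega
    _ = N * 2 ^ (Y + 2) := by ring
    _ = _ := by rw [hY, add_assoc _ (m + 6)]

theorem eval_bound_le (f : Polynomial ℕ) (ψ : LTL m kT) (kL : ℕ) (hn : 0 < n) :
    f.eval (bound ψ kL n) ≤ f.eval 1 * n ^ f.natDegree * 2 ^ (ψ.size *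
      2 ^ (max kT kL ^ 2 + (m + 2) * max kT kL + (m + 8) + f.natDegree)) := by
  set d := f.natDegree
  have hbound := bound_le ψ kL hn
  set r := max kT kL ^ 2 + (m + 2) * max kT kL + (m + 8)
  have hpos : 1 ≤ n * 2 ^ (ψ.size * 2 ^ r) := Nat.mul_pos hn (by positivity)
  calc f.eval (bound ψ kL n)
      ≤ f.eval (n * 2 ^ (ψ.size * 2 ^ r)) := monotone_polynomial_eval f hbound
    _ ≤ f.eval 1 * (n * 2 ^ (ψ.size * 2 ^ r)) ^ d := eval_le_eval_one_mul_pow f hpos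
    _ = f.eval 1 * n ^ d * 2 ^ (ψ.size * (2 ^ r * d)) := by
        rw [mul_pow, ← pow_mul, mul_assoc, mul_assoc]
    _ ≤ f.eval 1 * n ^ d * 2 ^ (ψ.size * (2 ^ r * 2 ^ d)) := by
        gcongr; exacts [one_le_two, Nat.lt_two_pow_self.le]
    _ = f.eval 1 * n ^ d * 2 ^ (ψ.size * 2 ^ (r + d)) := by rw [pow_add 2 r]

end BadPrefix

theorem mainTheorem9_general :
    ∃ prog : RAM.Prog, ∀ m : ℕ, ∃ P R : Polynomial ℕ,
      ∀ (kT kL n : ℕ) (ψ : LTL m kT) (A : DFA (Fin kL → Letter m) (Fin n)),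
        RAM.DecidesWithin prog (inputStore ψ A)
          (AcceptsOnlyBadPrefixes A (HyperLTL.univ ψ))
          (P.eval n * 2 ^ (ψ.size * 2 ^ (R.eval (max kT kL)))) := by
  obtain ⟨f, hf⟩ := BadPrefix.exists_decidesWithin
  refine ⟨BadPrefix.program, fun m => ⟨.C (f.eval 1) * .X ^ f.natDegree,
    .X ^ 2 + .C (m + 2) * .X + .C (m + 8) + .C f.natDegree, fun kT kL n ψ A => ?_⟩⟩
  obtain ⟨t, ht, hrun⟩ := hf ψ A
  refine ⟨t, ht.trans ?_, hrun⟩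
  simp only [Polynomial.eval_mul, Polynomial.eval_add, Polynomial.eval_pow, Polynomial.eval_X,
    Polynomial.eval_C]
  exact BadPrefix.eval_bound_le f ψ kL A.start.pos

theorem mainTheorem9 :
    ∃ prog : RAM.Prog, ∀ m : ℕ, ∃ P R : Polynomial ℕ,
      ∀ (kT kL n : ℕ) (ψ : LTL m kT) (A : DFA (Fin kL → Letter m) (Fin n)),
        ψ.IsSafety →
        RAM.DecidesWithin prog (inputStore ψ A)
          (AcceptsOnlyBadPrefixes A (HyperLTL.univ ψ))
          (P.eval n * 2 ^ (ψ.size * 2 ^ (R.eval (max kT kL)))) := by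
  obtain ⟨prog, h⟩ := mainTheorem9_general
  exact ⟨prog, fun m => (h m).imp fun P => Exists.imp fun R hR kT kL n ψ A _ => hR kT kL n ψ A⟩
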